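/- Let $(\Omega,\mathcal F,P)$ be a probability space and let $\ell:\mathbb R^d\to\mathbb R$ be a permutation invariant loss function, that is: $\ell$ is increasing for the componentwise order, convex, lower semicontinuous, $\inf\ell<0$, $\ell(x)\ge\sum_k x_k-c$ for some constant $c$, and $\ell(\pi(x))=\ell(x)$ for every permutation $\pi$ of the components. Suppose that $\ell$ is twice differentiable. Let $M^\theta$ be the set of $\mathbb R^d$-valued random vectors $X$ with $E[\ell(|rX|)]<\infty$ for all $r\ge 0$, where $|\cdot|$ is the componentwise absolute value. For $X\in M^\theta$ let $A(X)=\{m\in\mathbb R^d: E[\ell(X-m)]\le 0\}$ and $R(X)=\inf\{\sum_k m_k: m\in A(X)\}$. A risk allocation of $X$ is an $m\in A(X)$ with $\sum_k m_k=R(X)$; if it is unique it is denoted by $RA(X)$. A saddle point for $X$ is a pair $(m,\lambda)\in\mathbb R^d\times(0,\infty)$ at which $L(m,\lambda,X)=\sum_k m_k+\lambda E[\ell(X-m)]$ is minimal in $m\in\mathbb R^d$ and maximal in $\lambda>0$. Let $X,Y\in M^\theta$ and let $(m,\lambda)$ be a saddle point for $X$ such that $E[\nabla^2\ell(X-n)]$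 exists (with all entries integrable) for all $n$ in a neighbourhood of $m$ and is continuous in $n$ at $n=m$, and such that the $(d+1)\times(d+1)$ matrix $$M=\begin{bmatrix}\lambda E[\nabla^2\ell(X-m)] & -1/\lambda\\ 1 & 0\end{bmatrix}$$ is non-singular, where the off-diagonal blocks are the column with all entries $-1/\lambda$ and the row with all entries $1$. Suppose that $Y$ is independent of $X$. Then there is $t_0>0$ such that for every $0\le t\le t_0$ the saddle point and the risk allocation for $X+tY$ exist and are unique, and $$R(X;Y):=\limsup_{t\searrow0}\frac{R(X+tY)-R(X)}{t}=\sum_{k=1}^d E[Y_k],$$ $$RA_k(X;Y):=\limsup_{t\searrow0}\frac{RA_k(X+tY)-RA_k(X)}{t}=E[Y_k],\qquad k=1,\dots,d.$$ In other words, each component bears exactly the expected independent shock it receives. -/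

import Mathlib

open MeasureTheory ProbabilityTheory Filter Topology Set

noncomputable section

namespace ShortfallRisk

/-- Loss functions on `ℝ^d` (real-valued, since twice differentiability is assumed on all of `ℝ^d`).
The order on `Fin d → ℝ` is the componentwise one. -/
structure IsLossFunction {d : ℕ} (ℓ : (Fin d → ℝ) → ℝ) : Prop where
  increasing : Monotone ℓ
  convex : ConvexOn ℝ univ ℓ
  lowerSemicontinuous : LowerSemicontinuous ℓ
  exists_neg : ∃ x, ℓ x < 0
  risk_averse : ∃ c : ℝ, ∀ x, (∑ k, x k) - c ≤ ℓ x

/-- Invariance under permutations of the components. -/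
def PermutationInvariant {d : ℕ} (ℓ : (Fin d → ℝ) → ℝ) : Prop :=
  ∀ (π : Equiv.Perm (Fin d)) (x : Fin d → ℝ), ℓ (fun k => x (π k)) = ℓ x

/-- Membership in the Orlicz heart `M^θ`, `θ x = ℓ |x|` with the componentwise absolute value.
As `θ` is continuous and bounded below, `E[θ(rX)] < ∞` means integrability. -/
def MemOrliczHeart {d : ℕ} {Ω : Type*} [MeasurableSpace Ω] (ℓ : (Fin d → ℝ) → ℝ) (P : Measure Ω)
    (X : Ω → Fin d → ℝ) : Prop :=
  AEMeasurable X P ∧ ∀ r : ℝ, 0 ≤ r → Integrable (fun ω => ℓ |r • X ω|) P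

/-- The expected loss `E[ℓ(X - m)]`; the integrand is integrable when `X` is in the
Orlicz heart of a loss function. -/
def expectedLoss {d : ℕ} {Ω : Type*} [MeasurableSpace Ω] (ℓ : (Fin d → ℝ) → ℝ) (P : Measure Ω)
    (X : Ω → Fin d → ℝ) (m : Fin d → ℝ) : ℝ :=
  ∫ ω, ℓ (X ω - m) ∂P

/-- The set `A(X)` of acceptable monetary allocations. -/
def acceptable {d : ℕ} {Ω : Type*} [MeasurableSpace Ω] (ℓ : (Fin d → ℝ) → ℝ) (P : Measure Ω)
    (X : Ω → Fin d → ℝ) : Set (Fin d → ℝ) :=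
  {m | expectedLoss ℓ P X m ≤ 0}

/-- The multivariate shortfall risk `R(X) = inf {∑ m_k : m ∈ A(X)}`. -/
def risk {d : ℕ} {Ω : Type*} [MeasurableSpace Ω] (ℓ : (Fin d → ℝ) → ℝ) (P : Measure Ω)
    (X : Ω → Fin d → ℝ) : ℝ :=
  sInf ((fun m : Fin d → ℝ => ∑ k, m k) '' acceptable ℓ P X)

/-- `m` is a risk allocation of `X`: it is acceptable and has aggregate cost `R(X)`. -/
def IsRiskAllocation {d : ℕ} {Ω : Type*} [MeasurableSpace Ω] (ℓ : (Fin d → ℝ) → ℝ)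
    (P : Measure Ω) (X : Ω → Fin d → ℝ) (m : Fin d → ℝ) : Prop :=
  m ∈ acceptable ℓ P X ∧ risk ℓ P X = ∑ k, m k

/-- `RA(X)`: the risk allocation of `X`, meaningful when there is exactly one. -/
def riskAllocation {d : ℕ} {Ω : Type*} [MeasurableSpace Ω] (ℓ : (Fin d → ℝ) → ℝ)
    (P : Measure Ω) (X : Ω → Fin d → ℝ) : Fin d → ℝ :=
  Classical.epsilon fun m => IsRiskAllocation ℓ P X m

/-- The Lagrangian `L(m, lam, X) = ∑ m_k + lam * E[ℓ(X - m)]`. -/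
def lagrangian {d : ℕ} {Ω : Type*} [MeasurableSpace Ω] (ℓ : (Fin d → ℝ) → ℝ) (P : Measure Ω)
    (X : Ω → Fin d → ℝ) (m : Fin d → ℝ) (lam : ℝ) : ℝ :=
  (∑ k, m k) + lam * expectedLoss ℓ P X m

/-- `(m, lam)` is a saddle point of the Lagrangian, minimal in `m ∈ ℝ^d` and maximal in
`lam > 0`; that is, `(m, lam) ∈ B(X) × C(X)`. -/
def IsSaddlePoint {d : ℕ} {Ω : Type*} [MeasurableSpace Ω] (ℓ : (Fin d → ℝ) → ℝ)
    (P : Measure Ω) (X : Ω → Fin d → ℝ) (m : Fin d → ℝ) (lam : ℝ) : Prop :=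
  0 < lam ∧
    (∀ m' : Fin d → ℝ, lagrangian ℓ P X m lam ≤ lagrangian ℓ P X m' lam) ∧
    (∀ lam' : ℝ, 0 < lam' → lagrangian ℓ P X m lam' ≤ lagrangian ℓ P X m lam)

/-- `ℓ` is (everywhere) twice differentiable. -/
def TwiceDifferentiable {d : ℕ} (ℓ : (Fin d → ℝ) → ℝ) : Prop :=
  Differentiable ℝ ℓ ∧ Differentiable ℝ (fderiv ℝ ℓ)

/-- The Hessian matrix `∇²ℓ(x)`. -/
def hessian {d : ℕ} (ℓ : (Fin d → ℝ) → ℝ) (x : Fin d → ℝ) : Matrix (Fin d) (Fin d) ℝ :=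
  Matrix.of fun i j => fderiv ℝ (fderiv ℝ ℓ) x (Pi.single i 1) (Pi.single j 1)

/-- The matrix `E[∇²ℓ(X - m)]`. -/
def expectedHessian {d : ℕ} {Ω : Type*} [MeasurableSpace Ω] (ℓ : (Fin d → ℝ) → ℝ)
    (P : Measure Ω) (X : Ω → Fin d → ℝ) (m : Fin d → ℝ) : Matrix (Fin d) (Fin d) ℝ :=
  Matrix.of fun i j => ∫ ω, hessian ℓ (X ω - m) i j ∂P

/-- The bordered matrix `[lam * E[∇²ℓ(X - m)], -1/lam; 1, 0]` of size `d + 1`. -/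
def saddleMatrix {d : ℕ} {Ω : Type*} [MeasurableSpace Ω] (ℓ : (Fin d → ℝ) → ℝ)
    (P : Measure Ω) (X : Ω → Fin d → ℝ) (m : Fin d → ℝ) (lam : ℝ) :
    Matrix (Fin d ⊕ Unit) (Fin d ⊕ Unit) ℝ :=
  Matrix.fromBlocks (lam • expectedHessian ℓ P X m) (Matrix.of fun _ _ => -1 / lam)
    (Matrix.of fun _ _ => 1) 0

/-- The expectations `E[∇²ℓ(X - n)]` exist for all `n` near `m` and depend continuously on `n`
at `n = m`. -/
def HessianRegularAt {d : ℕ} {Ω : Type*} [MeasurableSpace Ω] (ℓ : (Fin d → ℝ) → ℝ)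
    (P : Measure Ω) (X : Ω → Fin d → ℝ) (m : Fin d → ℝ) : Prop :=
  (∀ᶠ n in 𝓝 m, ∀ i j, Integrable (fun ω => hessian ℓ (X ω - n) i j) P) ∧
    ContinuousAt (fun n => expectedHessian ℓ P X n) m

/-- The marginal risk contribution `R(X;Y)`, an upper limit taken in the extended reals. -/
def marginalRisk {d : ℕ} {Ω : Type*} [MeasurableSpace Ω] (ℓ : (Fin d → ℝ) → ℝ) (P : Measure Ω)
    (X Y : Ω → Fin d → ℝ) : EReal :=
  limsup (fun t : ℝ => (((risk ℓ P (X + t • Y) - risk ℓ P X) / t : ℝ) : EReal)) (𝓝[>] 0)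

/-- The risk allocation marginal `RA_k(X;Y)`, an upper limit taken in the extended reals. -/
def marginalAllocation {d : ℕ} {Ω : Type*} [MeasurableSpace Ω] (ℓ : (Fin d → ℝ) → ℝ)
    (P : Measure Ω) (X Y : Ω → Fin d → ℝ) (k : Fin d) : EReal :=
  limsup (fun t : ℝ =>
    (((riskAllocation ℓ P (X + t • Y) k - riskAllocation ℓ P X k) / t : ℝ) : EReal)) (𝓝[>] 0)

end ShortfallRisk

end

/-!
Write `F n = E[ℓ(X - n)]`, a convex antitone differentiable function (`hasFDerivAt_integral_sub`),
and let `b = E[Y]`. By independence `E[ℓ(X + tY - n)] = E[F(n - tY)]`, the average of `F` over small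
random shifts (`expectedLoss_add_smul`). For small `t` this average behaves near `m` like the
translate of `F` by `t b`, and its minimisers therefore move with velocity `b`.

The second order input concerns `F` alone. Along segments near `m` the expected Hessian integrates
to the gradient increments of `F` (`fderiv_integral_sub_apply_sub`); hence `∇F` is differentiable at
`m` (`hasFDerivAt_fderiv_integral_sub`). The expected Hessian is positive semidefinite, and
nonsingularity of the bordered matrix says that it is definite on the directions of total zero
(`eq_zero_of_expectedHessian_mulVec_eq_zero`); by continuity `F` is strongly convex near `m` along
these directions (`exists_fderiv_add_sq_le`). Nothing is known about `F` far from `m`, so the large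
values of `Y` need care. They are controlled by the first order bound
`r ‖∇F(z)‖ ≤ F(z - r 1) - F(z)` (`mul_norm_fderiv_le`), whose right side is integrable for
`r` proportional to `‖Y‖` because permutation invariance allows all components of `Y` to be replaced
by the largest one (`MemOrliczHeart.norm_smul_one`). Second moments of `Y` need not exist, which is
why only gradients, never second order expansions of `F`, are averaged
(`exists_norm_fderiv_sub_le`).

A saddle point is a point with `F = 0` and `∇F = -1/λ` in every component (`isSaddlePoint_iff`). The
strong convexity passes to the averages over shifts (`exists_shiftAverage_strong`). It confines the
minimisation to a small ball, which gives existence, and makes the minimiser `n_t` unique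
(`exists_unique_minimizer`). The tangent plane of `F` at `m` yields
`R(X + tY) ≥ R(X) + t ∑ b_k`, while `m + t (b + ε 1)` is acceptable for small `t`
(`eventually_shiftAverage_neg`); thus the total of `n_t` has derivative `∑ b_k`. Finally, at
`m + t b + o(t)` the averaged gradient differs from `∇F(m)` by `t D(b - E[Y]) + o(t) = o(t)`
(`tendsto_integral_fderiv_sub`), where `D` is the expected Hessian, and strong convexity turns this
into `n_t = m + t b + o(t)` (`tendsto_minimizer`).
-/

namespace ShortfallRisk

/-! ### Differentiable convex functions and antitone convex functions on `ℝ^d` -/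

/-- The tangent plane of a convex function lies below its graph. -/
lemma add_fderiv_le_of_convexOn {E : Type*} [NormedAddCommGroup E] [NormedSpace ℝ E] {f : E → ℝ}
    (hf : ConvexOn ℝ univ f) {x : E} (hx : DifferentiableAt ℝ f x) (v : E) :
    f x + fderiv ℝ f x v ≤ f (x + v) := by
  have hline : ConvexOn ℝ univ (fun s : ℝ => f (x + s • v)) := by
    have h := hf.comp_affineMap (AffineMap.lineMap x (x + v) : ℝ →ᵃ[ℝ] E)
    rw [preimage_univ] at h
    refine h.congr fun s _ => ?_
    simp [AffineMap.lineMap_apply, add_comm]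
  have hder : HasDerivAt (fun s : ℝ => f (x + s • v)) (fderiv ℝ f x v) 0 := by
    have h1 : HasDerivAt (fun s : ℝ => x + s • v) v 0 := by
      simpa using ((hasDerivAt_id (0 : ℝ)).smul_const v).const_add x
    have h2 : HasFDerivAt f (fderiv ℝ f x) (x + (0 : ℝ) • v) := by simpa using hx.hasFDerivAt
    exact h2.comp_hasDerivAt 0 h1
  have h := hline.le_slope_of_hasDerivAt (mem_univ 0) (mem_univ 1) one_pos hder
  simp [slope_def_field] at h
  linarith

lemma neg_norm_smul_one_le {d : ℕ} (v : Fin d → ℝ) : -(‖v‖ • (1 : Fin d → ℝ)) ≤ v := by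
  intro k
  have := norm_le_pi_norm v k
  rw [Real.norm_eq_abs] at this
  have := neg_abs_le (v k)
  simp
  linarith

lemma le_norm_smul_one {d : ℕ} (v : Fin d → ℝ) : v ≤ ‖v‖ • (1 : Fin d → ℝ) := by
  intro k
  have := norm_le_pi_norm v k
  rw [Real.norm_eq_abs] at this
  have := le_abs_self (v k)
  simp
  linarith

/-- For an antitone convex function the derivative is a negative functional, so that its norm dual
to the sup norm is `-F'(z) 1`, which convexity bounds by a difference quotient of any length. -/
lemma mul_norm_fderiv_le {d : ℕ} {F : (Fin d → ℝ) → ℝ} (hconv : ConvexOn ℝ univ F)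
    (hanti : Antitone F) (hdiff : Differentiable ℝ F) (z : Fin d → ℝ) {r : ℝ} (hr : 0 ≤ r) :
    r * ‖fderiv ℝ F z‖ ≤ F (z - r • 1) - F z := by
  have hneg : ∀ v : Fin d → ℝ, 0 ≤ v → fderiv ℝ F z v ≤ 0 := fun v hv => by
    have h1 := add_fderiv_le_of_convexOn hconv (hdiff z) v
    have h2 : F (z + v) ≤ F z := hanti (le_add_of_nonneg_right hv)
    linarith
  have hnorm : ‖fderiv ℝ F z‖ ≤ -fderiv ℝ F z 1 := by
    refine ContinuousLinearMap.opNorm_le_bound _ ?_ fun v => ?_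
    · have := hneg 1 (fun _ => zero_le_one)
      linarith
    · have h1 := hneg (‖v‖ • 1 - v) (sub_nonneg.2 (le_norm_smul_one v))
      have h2 := hneg (v - -(‖v‖ • 1)) (sub_nonneg.2 (neg_norm_smul_one_le v))
      simp only [map_sub, map_neg, map_smul, smul_eq_mul] at h1 h2
      rw [Real.norm_eq_abs, abs_le]
      constructor <;> linarith
  have h := add_fderiv_le_of_convexOn hconv (hdiff z) (-(r • 1))
  simp only [map_neg, map_smul, smul_eq_mul] at h
  rw [sub_eq_add_neg z]
  have := mul_le_mul_of_nonneg_left hnorm hr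
  linarith

/-- Differentiation under the expectation for an antitone convex function. No domination has to be
assumed: the derivative is dominated by differences of the function itself. -/
lemma hasFDerivAt_integral_sub {d : ℕ} {Ω : Type*} [MeasurableSpace Ω] {P : Measure Ω}
    {F : (Fin d → ℝ) → ℝ} (hconv : ConvexOn ℝ univ F) (hanti : Antitone F)
    (hdiff : Differentiable ℝ F) {Z : Ω → Fin d → ℝ} (hZ : AEMeasurable Z P)
    (hint : ∀ n, Integrable (fun ω => F (n - Z ω)) P) (n : Fin d → ℝ) :
    Integrable (fun ω => fderiv ℝ F (n - Z ω)) P ∧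
      HasFDerivAt (fun n => ∫ ω, F (n - Z ω) ∂P) (∫ ω, fderiv ℝ F (n - Z ω) ∂P) n := by
  have hmeas : AEStronglyMeasurable (fun ω => fderiv ℝ F (n - Z ω)) P :=
    ((measurable_fderiv ℝ F).comp_aemeasurable (hZ.const_sub n)).aestronglyMeasurable
  have hbound : ∀ x ∈ Metric.ball n 1, ∀ ω, ‖fderiv ℝ F (x - Z ω)‖ ≤
      F (n - (2 : ℝ) • 1 - Z ω) - F (n + 1 - Z ω) := fun x hx ω => by
    have h := mul_norm_fderiv_le hconv hanti hdiff (x - Z ω) zero_le_one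
    rw [one_mul, one_smul] at h
    have hxn : ‖x - n‖ ≤ 1 := (mem_ball_iff_norm.1 hx).le
    have h1 : F (x - Z ω - 1) ≤ F (n - (2 : ℝ) • 1 - Z ω) := hanti fun k => by
      have := (abs_le.1 ((norm_le_pi_norm (x - n) k).trans hxn)).1
      simp at this ⊢
      linarith
    have h2 : F (n + 1 - Z ω) ≤ F (x - Z ω) := hanti fun k => by
      have := (abs_le.1 ((norm_le_pi_norm (x - n) k).trans hxn)).2
      simp at this ⊢
      linarith
    linarith
  have hder : HasFDerivAt (fun n => ∫ ω, F (n - Z ω) ∂P) (∫ ω, fderiv ℝ F (n - Z ω) ∂P) n :=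
    hasFDerivAt_integral_of_dominated_of_fderiv_le (F' := fun x ω => fderiv ℝ F (x - Z ω))
      (Metric.ball_mem_nhds n one_pos) (Eventually.of_forall fun x => (hint x).1) (hint n) hmeas
      (Eventually.of_forall fun ω x hx => hbound x hx ω) ((hint _).sub (hint _))
      (Eventually.of_forall fun ω x _ => by
        have h := (hdiff (x - Z ω)).hasFDerivAt.comp x ((hasFDerivAt_id x).sub_const (Z ω))
        rwa [ContinuousLinearMap.comp_id] at h)
  exact ⟨((hint _).sub (hint _)).mono' hmeas
    (Eventually.of_forall fun ω => hbound n (Metric.mem_ball_self one_pos) ω), hder⟩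

lemma convexOn_integral_sub {d : ℕ} {Ω : Type*} [MeasurableSpace Ω] {P : Measure Ω}
    {F : (Fin d → ℝ) → ℝ} (hconv : ConvexOn ℝ univ F) {Z : Ω → Fin d → ℝ}
    (hint : ∀ n, Integrable (fun ω => F (n - Z ω)) P) :
    ConvexOn ℝ univ (fun n => ∫ ω, F (n - Z ω) ∂P) := by
  refine ⟨convex_univ, fun x _ y _ a b ha hb hab => ?_⟩
  rw [smul_eq_mul, smul_eq_mul, ← integral_const_mul, ← integral_const_mul,
    ← integral_add ((hint x).const_mul a) ((hint y).const_mul b)]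
  refine integral_mono (hint _) (((hint x).const_mul a).add ((hint y).const_mul b)) fun ω => ?_
  have h := hconv.2 (mem_univ (x - Z ω)) (mem_univ (y - Z ω)) ha hb hab
  have he : a • (x - Z ω) + b • (y - Z ω) = a • x + b • y - Z ω := by
    rw [smul_sub, smul_sub, sub_add_sub_comm, ← add_smul, hab, one_smul]
  rw [he] at h
  simpa using h

lemma antitone_integral_sub {d : ℕ} {Ω : Type*} [MeasurableSpace Ω] {P : Measure Ω}
    {F : (Fin d → ℝ) → ℝ} (hanti : Antitone F) {Z : Ω → Fin d → ℝ}
    (hint : ∀ n, Integrable (fun ω => F (n - Z ω)) P) :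
    Antitone (fun n => ∫ ω, F (n - Z ω) ∂P) := fun _ _ hxy =>
  integral_mono (hint _) (hint _) fun _ => hanti (sub_le_sub_right hxy _)

/-! ### Second derivatives of convex functions -/

section SecondDerivative

-- `E →L[ℝ] E →L[ℝ] ℝ` finds its `ContinuousENorm` instance only at a greater search depth.
set_option maxSynthPendingDepth 6

lemma hasDerivAt_fderiv_add_smul_apply {E : Type*} [NormedAddCommGroup E] [NormedSpace ℝ E]
    {f : E → ℝ} (hd2 : Differentiable ℝ (fderiv ℝ f)) (u v w : E) (s : ℝ) :
    HasDerivAt (fun s : ℝ => fderiv ℝ f (u + s • v) w)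
      (fderiv ℝ (fderiv ℝ f) (u + s • v) v w) s := by
  have h1 : HasDerivAt (fun s : ℝ => u + s • v) v s := by
    simpa using ((hasDerivAt_id s).smul_const v).const_add u
  have h2 : HasFDerivAt (fun u => fderiv ℝ f u w)
      ((ContinuousLinearMap.apply ℝ ℝ w).comp (fderiv ℝ (fderiv ℝ f) (u + s • v))) (u + s • v) :=
    (ContinuousLinearMap.apply ℝ ℝ w).hasFDerivAt.comp _ (hd2 _).hasFDerivAt
  exact h2.comp_hasDerivAt s h1

lemma sndFDeriv_nonneg_of_convexOn {E : Type*} [NormedAddCommGroup E] [NormedSpace ℝ E] {f : E → ℝ}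
    (hconv : ConvexOn ℝ univ f) (hd : Differentiable ℝ f) (hd2 : Differentiable ℝ (fderiv ℝ f))
    (u v : E) : 0 ≤ fderiv ℝ (fderiv ℝ f) u v v := by
  have hder := hasDerivAt_fderiv_add_smul_apply hd2 u v v 0
  rw [zero_smul, add_zero] at hder
  refine hder.nonneg_of_monotone fun a b hab => ?_
  rcases hab.eq_or_lt with rfl | hab
  · exact le_rfl
  have h1 := add_fderiv_le_of_convexOn hconv (hd (u + a • v)) ((b - a) • v)
  have h2 := add_fderiv_le_of_convexOn hconv (hd (u + b • v)) ((a - b) • v)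
  rw [add_assoc, ← add_smul, add_sub_cancel, map_smul, smul_eq_mul] at h1 h2
  nlinarith

lemma sndFDeriv_comm {E : Type*} [NormedAddCommGroup E] [NormedSpace ℝ E] {f : E → ℝ}
    (hd : Differentiable ℝ f) (hd2 : Differentiable ℝ (fderiv ℝ f)) (u v w : E) :
    fderiv ℝ (fderiv ℝ f) u v w = fderiv ℝ (fderiv ℝ f) u w v :=
  second_derivative_symmetric (𝕜 := ℝ) (fun y => (hd y).hasFDerivAt) (hd2 u).hasFDerivAt v w

lemma abs_sndFDeriv_le {E : Type*} [NormedAddCommGroup E] [NormedSpace ℝ E] {f : E → ℝ}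
    (hconv : ConvexOn ℝ univ f) (hd : Differentiable ℝ f) (hd2 : Differentiable ℝ (fderiv ℝ f))
    (u v w : E) : |fderiv ℝ (fderiv ℝ f) u v w| ≤
      fderiv ℝ (fderiv ℝ f) u v v + fderiv ℝ (fderiv ℝ f) u w w := by
  have h1 := sndFDeriv_nonneg_of_convexOn hconv hd hd2 u (v + w)
  have h2 := sndFDeriv_nonneg_of_convexOn hconv hd hd2 u (v - w)
  have h3 := sndFDeriv_nonneg_of_convexOn hconv hd hd2 u v
  have h4 := sndFDeriv_nonneg_of_convexOn hconv hd hd2 u w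
  have h5 := sndFDeriv_comm hd hd2 u v w
  simp only [map_add, map_sub, add_apply, sub_apply]
    at h1 h2
  rw [abs_le]
  constructor <;> linarith

/-- A positive semidefinite symmetric bilinear form has its isotropic vectors in its kernel. -/
lemma apply_eq_zero_of_apply_self_eq_zero {E : Type*} [NormedAddCommGroup E] [NormedSpace ℝ E]
    {B : E →L[ℝ] E →L[ℝ] ℝ} (hpos : ∀ v, 0 ≤ B v v) (hsymm : ∀ v w, B v w = B w v) {v : E}
    (hv : B v v = 0) (w : E) : B w v = 0 := by
  have hquad : ∀ s : ℝ, 0 ≤ B w w + 2 * s * B w v := fun s => by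
    have h := hpos (w + s • v)
    simp only [map_add, map_smul, add_apply, smul_apply,
      smul_eq_mul, hv, hsymm v w] at h
    linarith
  by_contra hne
  have h := hquad (-(B w w + 1) / (2 * B w v))
  have h2 : 2 * (-(B w w + 1) / (2 * B w v)) * B w v = -(B w w + 1) := by field_simp
  rw [h2] at h
  linarith

/-- The second derivative is only known to be integrable in the translation parameter. Along a
segment on which its expectations stay bounded it is jointly integrable, by positivity, so that the
fundamental theorem of calculus holds for almost every `x` and can be integrated over `x`. -/
lemma fderiv_integral_sub_apply_sub {d : ℕ} {μ : Measure (Fin d → ℝ)} [IsFiniteMeasure μ]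
    {Φ : (Fin d → ℝ) → ℝ} (hconv : ConvexOn ℝ univ Φ) (hanti : Antitone Φ)
    (hd : Differentiable ℝ Φ) (hd2 : Differentiable ℝ (fderiv ℝ Φ))
    (hint : ∀ n, Integrable (fun x => Φ (n - x)) μ) {z v : Fin d → ℝ} {C : ℝ}
    (hB : ∀ s ∈ Icc (0 : ℝ) 1, Integrable (fun x => fderiv ℝ (fderiv ℝ Φ) (z + s • v - x)) μ)
    (hC : ∀ s ∈ Icc (0 : ℝ) 1, ‖∫ x, fderiv ℝ (fderiv ℝ Φ) (z + s • v - x) ∂μ‖ ≤ C)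
    (w : Fin d → ℝ) :
    IntervalIntegrable (fun s : ℝ => (∫ x, fderiv ℝ (fderiv ℝ Φ) (z + s • v - x) ∂μ) v w)
      volume 0 1 ∧
    fderiv ℝ (fun n => ∫ x, Φ (n - x) ∂μ) (z + v) w - fderiv ℝ (fun n => ∫ x, Φ (n - x) ∂μ) z w =
      ∫ s in (0 : ℝ)..1, (∫ x, fderiv ℝ (fderiv ℝ Φ) (z + s • v - x) ∂μ) v w := by
  set B := fderiv ℝ (fderiv ℝ Φ) with hBdef
  have hmem : ∀ᵐ s ∂(volume.restrict (Ioc (0 : ℝ) 1)), s ∈ Icc (0 : ℝ) 1 :=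
    (ae_restrict_mem measurableSet_Ioc).mono fun s hs => Ioc_subset_Icc_self hs
  have happ : ∀ s ∈ Icc (0 : ℝ) 1, ∀ a b : Fin d → ℝ,
      Integrable (fun x => B (z + s • v - x) a b) μ ∧
      (∫ x, B (z + s • v - x) ∂μ) a b = ∫ x, B (z + s • v - x) a b ∂μ := fun s hs a b => by
    have h1 := (hB s hs).apply_continuousLinearMap a
    refine ⟨h1.apply_continuousLinearMap b, ?_⟩
    rw [ContinuousLinearMap.integral_apply (hB s hs), ContinuousLinearMap.integral_apply h1]
  have hmeas : Measurable (fun p : ℝ × (Fin d → ℝ) => B (z + p.1 • v - p.2) v w) := by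
    have h : Measurable (fun p : ℝ × (Fin d → ℝ) => B (z + p.1 • v - p.2)) :=
      (measurable_fderiv ℝ (fderiv ℝ Φ)).comp (by fun_prop)
    exact (ContinuousLinearMap.measurable_apply w).comp
      ((ContinuousLinearMap.measurable_apply v).comp h)
  have hjoint : Integrable (fun p : ℝ × (Fin d → ℝ) => B (z + p.1 • v - p.2) v w)
      ((volume.restrict (Ioc (0 : ℝ) 1)).prod μ) := by
    rw [integrable_prod_iff hmeas.aestronglyMeasurable]
    refine ⟨hmem.mono fun s hs => (happ s hs v w).1, ?_⟩
    refine Integrable.mono' (integrable_const (C * ‖v‖ * ‖v‖ + C * ‖w‖ * ‖w‖))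
      hmeas.aestronglyMeasurable.norm.integral_prod_right' (hmem.mono fun s hs => ?_)
    rw [Real.norm_of_nonneg (integral_nonneg fun _ => norm_nonneg _)]
    calc ∫ x, ‖B (z + s • v - x) v w‖ ∂μ
        ≤ ∫ x, (B (z + s • v - x) v v + B (z + s • v - x) w w) ∂μ :=
          integral_mono (happ s hs v w).1.norm ((happ s hs v v).1.add (happ s hs w w).1)
            fun x => abs_sndFDeriv_le hconv hd hd2 _ v w
      _ = (∫ x, B (z + s • v - x) ∂μ) v v + (∫ x, B (z + s • v - x) ∂μ) w w := by
          rw [integral_add (happ s hs v v).1 (happ s hs w w).1, (happ s hs v v).2,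
            (happ s hs w w).2]
      _ ≤ C * ‖v‖ * ‖v‖ + C * ‖w‖ * ‖w‖ := by
          have hbd : ∀ a : Fin d → ℝ, (∫ x, B (z + s • v - x) ∂μ) a a ≤ C * ‖a‖ * ‖a‖ := fun a =>
            (le_abs_self _).trans (((∫ x, B (z + s • v - x) ∂μ).le_opNorm₂ a a).trans
              (by gcongr; exact hC s hs))
          exact add_le_add (hbd v) (hbd w)
  have hset : ∀ᵐ s ∂(volume.restrict (Ioc (0 : ℝ) 1)),
      ∫ x, B (z + s • v - x) v w ∂μ = (∫ x, B (z + s • v - x) ∂μ) v w :=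
    hmem.mono fun s hs => (happ s hs v w).2.symm
  refine ⟨?_, ?_⟩
  · rw [intervalIntegrable_iff_integrableOn_Ioc_of_le zero_le_one]
    exact hjoint.integral_prod_left.congr hset
  have hFTC : ∀ᵐ x ∂μ, ∫ s in Ioc (0 : ℝ) 1, B (z + s • v - x) v w =
      fderiv ℝ Φ (z + v - x) w - fderiv ℝ Φ (z - x) w := by
    filter_upwards [hjoint.prod_left_ae] with x hx
    rw [← intervalIntegral.integral_of_le zero_le_one,
      intervalIntegral.integral_eq_sub_of_hasDerivAt
        (f := fun s : ℝ => fderiv ℝ Φ (z + s • v - x) w) (fun s _ => ?_)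
        ((intervalIntegrable_iff_integrableOn_Ioc_of_le zero_le_one).2 hx)]
    · simp
    · simpa only [sub_add_eq_add_sub] using hasDerivAt_fderiv_add_smul_apply hd2 (z - x) v w s
  have hF : ∀ n, Integrable (fun x => fderiv ℝ Φ (n - x) w) μ ∧
      fderiv ℝ (fun n => ∫ x, Φ (n - x) ∂μ) n w = ∫ x, fderiv ℝ Φ (n - x) w ∂μ := fun n => by
    obtain ⟨h1, h2⟩ := hasFDerivAt_integral_sub hconv hanti hd aemeasurable_id hint n
    simp only [id] at h1 h2
    refine ⟨h1.apply_continuousLinearMap w, ?_⟩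
    rw [← ContinuousLinearMap.integral_apply h1]
    exact congrArg (fun T : (Fin d → ℝ) →L[ℝ] ℝ => T w) h2.fderiv
  rw [(hF _).2, (hF _).2, ← integral_sub (hF _).1 (hF _).1, ← integral_congr_ae hFTC,
    ← integral_integral_swap hjoint, intervalIntegral.integral_of_le zero_le_one]
  exact integral_congr_ae hset

section SecondOrder

variable {d : ℕ} {μ : Measure (Fin d → ℝ)} [IsFiniteMeasure μ] {Φ : (Fin d → ℝ) → ℝ}
  {m : Fin d → ℝ}

lemma exists_ball_abs_fderiv_integral_sub_le (hconv : ConvexOn ℝ univ Φ) (hanti : Antitone Φ)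
    (hd : Differentiable ℝ Φ) (hd2 : Differentiable ℝ (fderiv ℝ Φ))
    (hint : ∀ n, Integrable (fun x => Φ (n - x)) μ)
    (hB : ∀ᶠ n in 𝓝 m, Integrable (fun x => fderiv ℝ (fderiv ℝ Φ) (n - x)) μ)
    (hcont : ContinuousAt (fun n => ∫ x, fderiv ℝ (fderiv ℝ Φ) (n - x) ∂μ) m) {ε : ℝ}
    (hε : 0 < ε) :
    ∃ ρ > 0, ∀ z ∈ Metric.ball m ρ, ∀ v, z + v ∈ Metric.ball m ρ → ∀ w,
      |fderiv ℝ (fun n => ∫ x, Φ (n - x) ∂μ) (z + v) w -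
        fderiv ℝ (fun n => ∫ x, Φ (n - x) ∂μ) z w -
          (∫ x, fderiv ℝ (fderiv ℝ Φ) (m - x) ∂μ) v w| ≤ ε * ‖v‖ * ‖w‖ := by
  set Q : (Fin d → ℝ) → _ := fun n => ∫ x, fderiv ℝ (fderiv ℝ Φ) (n - x) ∂μ with hQ
  obtain ⟨ρ, hρ, hball⟩ := Metric.eventually_nhds_iff_ball.1
    (hB.and (hcont.eventually (Metric.ball_mem_nhds _ hε)))
  refine ⟨ρ, hρ, fun z hz v hzv w => ?_⟩
  have hseg : ∀ s ∈ Icc (0 : ℝ) 1, z + s • v ∈ Metric.ball m ρ := fun s hs =>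
    (convex_ball m ρ).add_smul_mem hz hzv hs
  have hdist : ∀ s ∈ Icc (0 : ℝ) 1, ‖Q (z + s • v) - Q m‖ ≤ ε := fun s hs =>
    (mem_ball_iff_norm.1 (hball _ (hseg s hs)).2).le
  obtain ⟨hii, heq⟩ := fderiv_integral_sub_apply_sub hconv hanti hd hd2 hint
    (C := ‖Q m‖ + ε) (fun s hs => (hball _ (hseg s hs)).1)
    (fun s hs => by
      have := norm_le_norm_add_norm_sub' (Q (z + s • v)) (Q m)
      have := hdist s hs
      change ‖Q (z + s • v)‖ ≤ _
      linarith) w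
  have hconst : Q m v w = ∫ _ in (0 : ℝ)..1, Q m v w := by simp
  change |_ - Q m v w| ≤ _
  rw [heq, hconst, ← intervalIntegral.integral_sub hii intervalIntegrable_const]
  have h := intervalIntegral.norm_integral_le_of_norm_le_const
    (f := fun s : ℝ => Q (z + s • v) v w - Q m v w) (a := 0) (b := 1) (C := ε * ‖v‖ * ‖w‖)
    (fun s hs => by
      rw [uIoc_of_le zero_le_one] at hs
      calc ‖Q (z + s • v) v w - Q m v w‖ = ‖(Q (z + s • v) - Q m) v w‖ := rfl
        _ ≤ ‖Q (z + s • v) - Q m‖ * ‖v‖ * ‖w‖ := ContinuousLinearMap.le_opNorm₂ _ _ _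
        _ ≤ ε * ‖v‖ * ‖w‖ := by
            gcongr
            exact hdist s (Ioc_subset_Icc_self hs))
  simpa using h

lemma hasFDerivAt_fderiv_integral_sub (hconv : ConvexOn ℝ univ Φ) (hanti : Antitone Φ)
    (hd : Differentiable ℝ Φ) (hd2 : Differentiable ℝ (fderiv ℝ Φ))
    (hint : ∀ n, Integrable (fun x => Φ (n - x)) μ)
    (hB : ∀ᶠ n in 𝓝 m, Integrable (fun x => fderiv ℝ (fderiv ℝ Φ) (n - x)) μ)
    (hcont : ContinuousAt (fun n => ∫ x, fderiv ℝ (fderiv ℝ Φ) (n - x) ∂μ) m) :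
    HasFDerivAt (fderiv ℝ (fun n => ∫ x, Φ (n - x) ∂μ))
      (∫ x, fderiv ℝ (fderiv ℝ Φ) (m - x) ∂μ) m := by
  rw [hasFDerivAt_iff_isLittleO_nhds_zero, Asymptotics.isLittleO_iff]
  intro ε hε
  obtain ⟨ρ, hρ, h⟩ :=
    exists_ball_abs_fderiv_integral_sub_le hconv hanti hd hd2 hint hB hcont hε
  filter_upwards [Metric.ball_mem_nhds (0 : Fin d → ℝ) hρ] with v hv
  refine ContinuousLinearMap.opNorm_le_bound _ (by positivity) fun w => ?_
  exact h m (Metric.mem_ball_self hρ) v (by simpa using hv) w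

/-- Positive definiteness of the expected second derivative at the single point `m` along a subspace
gives a uniform quadratic lower bound over tangent planes, in the directions of that subspace and at
all base points near `m`. -/
lemma exists_fderiv_add_sq_le (hconv : ConvexOn ℝ univ Φ) (hanti : Antitone Φ)
    (hd : Differentiable ℝ Φ) (hd2 : Differentiable ℝ (fderiv ℝ Φ))
    (hint : ∀ n, Integrable (fun x => Φ (n - x)) μ)
    (hB : ∀ᶠ n in 𝓝 m, Integrable (fun x => fderiv ℝ (fderiv ℝ Φ) (n - x)) μ)
    (hcont : ContinuousAt (fun n => ∫ x, fderiv ℝ (fderiv ℝ Φ) (n - x) ∂μ) m)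
    {V : Submodule ℝ (Fin d → ℝ)}
    (hpos : ∀ v ∈ V, v ≠ 0 → 0 < (∫ x, fderiv ℝ (fderiv ℝ Φ) (m - x) ∂μ) v v) :
    ∃ c > 0, ∃ ρ > 0, ∀ z ∈ Metric.ball m ρ, ∀ v ∈ V, z + v ∈ Metric.ball m ρ →
      (∫ x, Φ (z - x) ∂μ) + fderiv ℝ (fun n => ∫ x, Φ (n - x) ∂μ) z v + c * ‖v‖ ^ 2 ≤
        ∫ x, Φ (z + v - x) ∂μ := by
  set D := ∫ x, fderiv ℝ (fderiv ℝ Φ) (m - x) ∂μ with hD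
  set G : (Fin d → ℝ) → ℝ := fun n => ∫ x, Φ (n - x) ∂μ with hG
  obtain ⟨c, hc, hDc⟩ : ∃ c > 0, ∀ v ∈ V, c * ‖v‖ ^ 2 ≤ D v v := by
    have hcomp : IsCompact (Metric.sphere (0 : Fin d → ℝ) 1 ∩ V) :=
      (isCompact_sphere 0 1).inter_right V.closed_of_finiteDimensional
    have hcts : Continuous fun v => D v v := by fun_prop
    obtain ⟨c, hc, hcle⟩ : ∃ c > 0, ∀ v ∈ Metric.sphere (0 : Fin d → ℝ) 1 ∩ V, c ≤ D v v := by
      rcases (Metric.sphere (0 : Fin d → ℝ) 1 ∩ V).eq_empty_or_nonempty with he | hne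
      · exact ⟨1, one_pos, fun v hv => by simp [he] at hv⟩
      · obtain ⟨u, hu, hmin⟩ := hcomp.exists_isMinOn hne hcts.continuousOn
        exact ⟨D u u, hpos u hu.2 (by rintro rfl; simp at hu), fun v hv => hmin hv⟩
    refine ⟨c, hc, fun v hv => ?_⟩
    rcases eq_or_ne v 0 with rfl | hv0
    · simp
    have hn : ‖v‖ ≠ 0 := norm_ne_zero_iff.2 hv0
    have h := hcle (‖v‖⁻¹ • v) ⟨by simp [norm_smul, hn], V.smul_mem _ hv⟩
    simp only [map_smul, smul_apply, smul_eq_mul] at h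
    calc c * ‖v‖ ^ 2 ≤ ‖v‖⁻¹ * (‖v‖⁻¹ * D v v) * ‖v‖ ^ 2 := by gcongr
      _ = D v v := by field_simp
  obtain ⟨ρ, hρ, h⟩ :=
    exists_ball_abs_fderiv_integral_sub_le hconv hanti hd hd2 hint hB hcont (half_pos hc)
  refine ⟨c / 4, by positivity, ρ, hρ, fun z hz v hv hzv => ?_⟩
  have hgrad : ∀ s ∈ Icc (0 : ℝ) 1,
      c / 2 * s ^ 2 * ‖v‖ ^ 2 ≤ s * (fderiv ℝ G (z + s • v) v - fderiv ℝ G z v) := fun s hs => by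
    have h1 := h z hz (s • v) ((convex_ball m ρ).add_smul_mem hz hzv hs) (s • v)
    have h2 := (abs_le.1 h1).1
    have h3 := hDc _ (V.smul_mem s hv)
    simp only [map_smul, smul_apply, smul_eq_mul, norm_smul,
      Real.norm_of_nonneg hs.1] at h2 h3
    change -(c / 2 * (s * ‖v‖) * (s * ‖v‖)) ≤
      s * fderiv ℝ G (z + s • v) v - s * fderiv ℝ G z v - s * (s * D v v) at h2
    nlinarith
  have hGd : ∀ n, HasFDerivAt G (fderiv ℝ G n) n := fun n =>
    (hasFDerivAt_integral_sub hconv hanti hd aemeasurable_id hint n).2.differentiableAt.hasFDerivAt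
  have hp : ∀ s : ℝ, HasDerivAt
      (fun s : ℝ => G (z + s • v) - s * fderiv ℝ G z v - c / 4 * ‖v‖ ^ 2 * s ^ 2)
      (fderiv ℝ G (z + s • v) v - fderiv ℝ G z v - c / 4 * ‖v‖ ^ 2 * (2 * s)) s := fun s => by
    have h1 : HasDerivAt (fun s : ℝ => z + s • v) v s := by
      simpa using ((hasDerivAt_id s).smul_const v).const_add z
    have h2 := (hGd (z + s • v)).comp_hasDerivAt s h1
    have h3 := (hasDerivAt_id s).mul_const (fderiv ℝ G z v)
    have h4 := (hasDerivAt_pow 2 s).const_mul (c / 4 * ‖v‖ ^ 2)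
    refine ((h2.sub h3).sub h4).congr_deriv ?_
    simp
  have hmono : MonotoneOn
      (fun s : ℝ => G (z + s • v) - s * fderiv ℝ G z v - c / 4 * ‖v‖ ^ 2 * s ^ 2) (Icc 0 1) := by
    refine monotoneOn_of_deriv_nonneg (convex_Icc 0 1)
      (fun s _ => (hp s).continuousAt.continuousWithinAt)
      (fun s _ => (hp s).differentiableAt.differentiableWithinAt) fun s hs => ?_
    rw [interior_Icc] at hs
    rw [(hp s).deriv]
    have h1 := hgrad s (Ioo_subset_Icc_self hs)
    have h2 : c / 2 * s * ‖v‖ ^ 2 ≤ fderiv ℝ G (z + s • v) v - fderiv ℝ G z v :=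
      le_of_mul_le_mul_left (by nlinarith) hs.1
    linarith
  have h01 := hmono (left_mem_Icc.2 zero_le_one) (right_mem_Icc.2 zero_le_one) zero_le_one
  simp only [zero_smul, add_zero, one_smul] at h01
  change G z + _ + _ ≤ G (z + v)
  linarith

end SecondOrder

end SecondDerivative

/-! ### Averaging a convex function over small random shifts -/

/-- The functional `v ↦ ∑ k, v k`. -/
noncomputable def total {d : ℕ} : (Fin d → ℝ) →L[ℝ] ℝ := ∑ k, ContinuousLinearMap.proj k

@[simp] lemma total_apply {d : ℕ} (v : Fin d → ℝ) : total v = ∑ k, v k := by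
  simp [total]

lemma total_one {d : ℕ} : total (1 : Fin d → ℝ) = d := by simp

/-- The average of `F` over the shifts `-t • y`, where `y` has law `ν`. -/
noncomputable def shiftAverage {d : ℕ} (F : (Fin d → ℝ) → ℝ) (ν : Measure (Fin d → ℝ)) (t : ℝ)
    (n : Fin d → ℝ) : ℝ := ∫ y, F (n - t • y) ∂ν

/-- A function `F` whose minimal total `total n` under the constraint `F n ≤ 0` is attained at `m`,
together with the law `ν` of the shocks that shift its argument. At `m` the gradient is `-λ⁻¹` in
every component and has the derivative `D`; around `m`, `F` is strongly convex along the directions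
of total zero, with modulus `c` on the ball of radius `ρ`. -/
structure ShiftProblem {d : ℕ} (F : (Fin d → ℝ) → ℝ) (ν : Measure (Fin d → ℝ)) (m : Fin d → ℝ)
    (lam : ℝ) (D : (Fin d → ℝ) →L[ℝ] (Fin d → ℝ) →L[ℝ] ℝ) (c ρ : ℝ) : Prop where
  dim_pos : 0 < d
  convex : ConvexOn ℝ univ F
  antitone : Antitone F
  differentiable : Differentiable ℝ F
  integrable_id : Integrable (fun y => y) ν
  integrable_norm_shift : ∀ n (r : ℝ), 0 ≤ r → Integrable (fun y => F (n - (r * ‖y‖) • 1)) ν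
  lam_pos : 0 < lam
  map_eq_zero : F m = 0
  fderiv_eq : ∀ v, fderiv ℝ F m v = -(lam⁻¹ * total v)
  hasFDerivAt : HasFDerivAt (fderiv ℝ F) D m
  c_pos : 0 < c
  ρ_pos : 0 < ρ
  strong : ∀ z ∈ Metric.ball m ρ, ∀ v, total v = 0 → z + v ∈ Metric.ball m ρ →
    F z + fderiv ℝ F z v + c * ‖v‖ ^ 2 ≤ F (z + v)

lemma norm_one_le {d : ℕ} : ‖(1 : Fin d → ℝ)‖ ≤ 1 :=
  (pi_norm_le_iff_of_nonneg zero_le_one).2 fun _ => by simp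

namespace ShiftProblem

variable {d : ℕ} {F : (Fin d → ℝ) → ℝ} {ν : Measure (Fin d → ℝ)} [IsProbabilityMeasure ν]
  {m : Fin d → ℝ} {lam : ℝ} {D : (Fin d → ℝ) →L[ℝ] (Fin d → ℝ) →L[ℝ] ℝ} {c ρ : ℝ}

lemma integrable_shift (h : ShiftProblem F ν m lam D c ρ) (t : ℝ) (n : Fin d → ℝ) :
    Integrable (fun y => F (n - t • y)) ν := by
  have hmeas : AEStronglyMeasurable (fun y => F (n - t • y)) ν :=
    (h.differentiable.continuous.comp (by fun_prop)).aestronglyMeasurable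
  have hlow : Integrable (fun y => F n + fderiv ℝ F n (-(t • y))) ν :=
    (integrable_const _).add ((fderiv ℝ F n).integrable_comp (h.integrable_id.smul t).neg)
  refine integrable_of_le_of_le hmeas (Eventually.of_forall fun y => ?_)
    (Eventually.of_forall fun y => ?_) hlow (h.integrable_norm_shift n |t| (abs_nonneg t))
  · simpa [sub_eq_add_neg] using add_fderiv_le_of_convexOn h.convex (h.differentiable n) (-(t • y))
  · refine h.antitone ?_
    have := le_norm_smul_one (t • y)
    rw [norm_smul, Real.norm_eq_abs] at this
    exact sub_le_sub_left this n

lemma integrable_fderiv (h : ShiftProblem F ν m lam D c ρ) (t : ℝ) (n : Fin d → ℝ) :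
    Integrable (fun y => fderiv ℝ F (n - t • y)) ν :=
  (hasFDerivAt_integral_sub h.convex h.antitone h.differentiable
    (Z := fun y => t • y) (by fun_prop) (h.integrable_shift t) n).1

lemma hasFDerivAt_shiftAverage (h : ShiftProblem F ν m lam D c ρ) (t : ℝ) (n : Fin d → ℝ) :
    HasFDerivAt (shiftAverage F ν t) (∫ y, fderiv ℝ F (n - t • y) ∂ν) n :=
  (hasFDerivAt_integral_sub h.convex h.antitone h.differentiable
    (Z := fun y => t • y) (by fun_prop) (h.integrable_shift t) n).2

lemma differentiable_shiftAverage (h : ShiftProblem F ν m lam D c ρ) (t : ℝ) :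
    Differentiable ℝ (shiftAverage F ν t) :=
  fun n => (h.hasFDerivAt_shiftAverage t n).differentiableAt

lemma fderiv_shiftAverage (h : ShiftProblem F ν m lam D c ρ) (t : ℝ) (n : Fin d → ℝ) :
    fderiv ℝ (shiftAverage F ν t) n = ∫ y, fderiv ℝ F (n - t • y) ∂ν :=
  (h.hasFDerivAt_shiftAverage t n).fderiv

lemma convexOn_shiftAverage (h : ShiftProblem F ν m lam D c ρ) (t : ℝ) :
    ConvexOn ℝ univ (shiftAverage F ν t) :=
  convexOn_integral_sub h.convex (h.integrable_shift t)

lemma shiftAverage_zero : shiftAverage F ν 0 = F := by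
  funext n
  simp [shiftAverage]

lemma integral_total_sub (h : ShiftProblem F ν m lam D c ρ) (t : ℝ) (u : Fin d → ℝ) :
    ∫ y, total (u - t • y) ∂ν = total u - t * total (∫ y, y ∂ν) := by
  have ht : Integrable (fun y => t • y) ν := h.integrable_id.smul t
  have hi : Integrable (fun y => u - t • y) ν := (integrable_const u).sub ht
  rw [ContinuousLinearMap.integral_comp_comm total hi,
    integral_sub (integrable_const u) ht, integral_smul]
  simp only [integral_const, probReal_univ, one_smul, map_sub, map_smul, smul_eq_mul]

/-- The tangent plane of `F` at `m` bounds every shift average from below. -/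
lemma le_shiftAverage (h : ShiftProblem F ν m lam D c ρ) (t : ℝ) (n : Fin d → ℝ) :
    -(lam⁻¹ * (total n - t * total (∫ y, y ∂ν) - total m)) ≤ shiftAverage F ν t n := by
  have hi : Integrable (fun y => total (n - m - t • y)) ν :=
    total.integrable_comp ((integrable_const (n - m)).sub (h.integrable_id.smul t))
  have h1 : ∫ y, -(lam⁻¹ * total (n - m - t • y)) ∂ν ≤ shiftAverage F ν t n := by
    refine integral_mono (hi.const_mul _).neg (h.integrable_shift t n) fun y => ?_
    have h2 := add_fderiv_le_of_convexOn h.convex (h.differentiable m) (n - m - t • y)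
    rw [h.map_eq_zero, h.fderiv_eq, zero_add] at h2
    convert! h2 using 2
    abel
  rw [integral_neg, integral_const_mul, h.integral_total_sub t] at h1
  rw [map_sub] at h1
  convert! h1 using 3
  ring

/-- Gradient increments of `F` at `m` are of order `t` after averaging: near `m` because the
gradient is differentiable there, and away from `m` because there `1 / t` is at most a multiple of
`‖y‖`, and `‖y‖` times the gradient is bounded by a difference of values of `F`. -/
lemma exists_norm_fderiv_sub_le (h : ShiftProblem F ν m lam D c ρ) {A : ℝ} (hA : 0 ≤ A) :
    ∃ G : (Fin d → ℝ) → ℝ, Integrable G ν ∧ ∀ t ∈ Icc (0 : ℝ) 1, ∀ a, ‖a‖ ≤ A → ∀ y,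
      ‖fderiv ℝ F (m + t • a - t • y) - fderiv ℝ F m‖ ≤ t * G y := by
  obtain ⟨C, hC, hCO⟩ := h.hasFDerivAt.isBigO_sub.exists_pos
  obtain ⟨δ, hδ, hball⟩ := Metric.eventually_nhds_iff_ball.1 hCO.bound
  refine ⟨fun y => C * (A + ‖y‖) + δ⁻¹ * (F (m - (2 * A) • 1 - (2 * ‖y‖) • 1) - F m +
    2 * (A + ‖y‖) * ‖fderiv ℝ F m‖), ?_, fun t ht a ha y => ?_⟩
  · have hn : Integrable (fun y => A + ‖y‖) ν := (integrable_const A).add h.integrable_id.norm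
    exact (hn.const_mul C).add ((((h.integrable_norm_shift _ 2 zero_le_two).sub
      (integrable_const _)).add ((hn.const_mul 2).mul_const _)).const_mul _)
  set z := m + t • a - t • y with hz
  set r := A + ‖y‖ with hr
  set K := F (m - (2 * A) • 1 - (2 * ‖y‖) • 1) - F m + 2 * r * ‖fderiv ℝ F m‖ with hK
  have hr0 : 0 ≤ r := by positivity
  have hzm : ‖z - m‖ ≤ t * r := by
    have : z - m = t • (a - y) := by rw [hz, smul_sub]; abel
    rw [this, norm_smul, Real.norm_of_nonneg ht.1]
    exact mul_le_mul_of_nonneg_left ((norm_sub_le a y).trans (by linarith)) ht.1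
  have hzm' : ‖z - m‖ ≤ r := hzm.trans (mul_le_of_le_one_left hr0 ht.2)
  have hle : m - (2 * A) • (1 : Fin d → ℝ) - (2 * ‖y‖) • 1 ≤ z - r • 1 := fun k => by
    have := neg_norm_smul_one_le (z - m) k
    simp at this ⊢
    linarith
  have hKr : r * (‖fderiv ℝ F z‖ + ‖fderiv ℝ F m‖) ≤ K := by
    have h1 := mul_norm_fderiv_le h.convex h.antitone h.differentiable z hr0
    have h2 := h.antitone hle
    have h3 := add_fderiv_le_of_convexOn h.convex (h.differentiable m) (z - m)
    rw [add_sub_cancel] at h3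
    have h4 : -(‖fderiv ℝ F m‖ * r) ≤ fderiv ℝ F m (z - m) := by
      have := (abs_le.1 ((fderiv ℝ F m).le_opNorm (z - m))).1
      have := mul_le_mul_of_nonneg_left hzm' (norm_nonneg (fderiv ℝ F m))
      linarith
    linarith
  have hK0 : 0 ≤ K := le_trans (by positivity) hKr
  by_cases hzδ : z ∈ Metric.ball m δ
  · calc ‖fderiv ℝ F z - fderiv ℝ F m‖ ≤ C * ‖z - m‖ := hball z hzδ
      _ ≤ C * (t * r) := by gcongr
      _ ≤ t * (C * r + δ⁻¹ * K) := by
          have : 0 ≤ t * (δ⁻¹ * K) := mul_nonneg ht.1 (by positivity)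
          linarith
  · have hδr : δ ≤ t * r := by
      rw [Metric.mem_ball, dist_eq_norm, not_lt] at hzδ
      exact hzδ.trans hzm
    have h1 : δ * ‖fderiv ℝ F z - fderiv ℝ F m‖ ≤ t * K :=
      calc δ * ‖fderiv ℝ F z - fderiv ℝ F m‖
          ≤ t * r * (‖fderiv ℝ F z‖ + ‖fderiv ℝ F m‖) :=
            mul_le_mul hδr (norm_sub_le _ _) (norm_nonneg _) (mul_nonneg ht.1 hr0)
        _ = t * (r * (‖fderiv ℝ F z‖ + ‖fderiv ℝ F m‖)) := by ring
        _ ≤ t * K := mul_le_mul_of_nonneg_left hKr ht.1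
    calc ‖fderiv ℝ F z - fderiv ℝ F m‖ = δ⁻¹ * (δ * ‖fderiv ℝ F z - fderiv ℝ F m‖) := by
          field_simp
      _ ≤ δ⁻¹ * (t * K) := by gcongr
      _ ≤ t * (C * r + δ⁻¹ * K) := by
          have : 0 ≤ t * (C * r) := mul_nonneg ht.1 (by positivity)
          linarith

/-- For a curve `m + t • a t` whose velocity tends to the mean of `ν`, the averaged gradient
increment has no term of first order: its limit is `D` applied to a centred variable. -/
lemma tendsto_integral_fderiv_sub (h : ShiftProblem F ν m lam D c ρ) {a : ℝ → Fin d → ℝ}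
    (ha : Tendsto a (𝓝[>] 0) (𝓝 (∫ y, y ∂ν))) :
    Tendsto (fun t : ℝ => ∫ y, t⁻¹ • (fderiv ℝ F (m + t • a t - t • y) - fderiv ℝ F m) ∂ν)
      (𝓝[>] 0) (𝓝 0) := by
  set b := ∫ y, y ∂ν with hb
  obtain ⟨G, hG, hGle⟩ := h.exists_norm_fderiv_sub_le (A := ‖b‖ + 1) (by positivity)
  have hlim : ∫ y, D (b - y) ∂ν = 0 := by
    have hi : Integrable (fun y => b - y) ν := (integrable_const b).sub h.integrable_id
    rw [ContinuousLinearMap.integral_comp_comm D hi,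
      integral_sub (integrable_const b) h.integrable_id]
    simp [← hb]
  rw [← hlim]
  refine tendsto_integral_filter_of_dominated_convergence G ?_ ?_ hG ?_
  · exact Eventually.of_forall fun t =>
      ((h.integrable_fderiv t _).1.sub aestronglyMeasurable_const).const_smul t⁻¹
  · have h1 : ∀ᶠ t : ℝ in 𝓝[>] 0, t ∈ Ioc (0 : ℝ) 1 := Ioc_mem_nhdsGT one_pos
    have h2 : ∀ᶠ t in 𝓝[>] 0, ‖a t‖ < ‖b‖ + 1 :=
      ha.norm.eventually (gt_mem_nhds (lt_add_one _))
    filter_upwards [h1, h2] with t ht hat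
    refine Eventually.of_forall fun y => ?_
    rw [norm_smul, norm_inv, Real.norm_of_nonneg ht.1.le, inv_mul_le_iff₀ ht.1]
    exact hGle t ⟨ht.1.le, ht.2⟩ (a t) hat.le y
  · refine Eventually.of_forall fun y => ?_
    have hc : Tendsto (fun t : ℝ => t • (a t - y)) (𝓝[>] 0) (𝓝 0) := by
      have h1 : Tendsto (fun t : ℝ => t) (𝓝[>] 0) (𝓝 0) := nhdsWithin_le_nhds
      simpa using h1.smul (ha.sub_const y)
    have hv : Tendsto (fun t : ℝ => t⁻¹ • t • (a t - y)) (𝓝[>] 0) (𝓝 (b - y)) := by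
      refine (ha.sub_const y).congr' ?_
      filter_upwards [self_mem_nhdsWithin] with t ht
      rw [smul_smul, inv_mul_cancel₀ (ne_of_gt ht), one_smul]
    refine (h.hasFDerivAt.hasFDerivWithinAt.lim hc (.of_forall fun _ => mem_univ _) hv).congr
      fun t => ?_
    rw [smul_sub t, add_sub_assoc]

/-- The strong convexity of `F` near `m` survives, with half the modulus, in the averages over
shifts so small that they stay near `m` with high probability. -/
lemma exists_shiftAverage_strong (h : ShiftProblem F ν m lam D c ρ) :
    ∃ t₁ > 0, ∀ t ∈ Icc (0 : ℝ) t₁, ∀ n ∈ Metric.ball m (ρ / 2), ∀ v, total v = 0 →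
      n + v ∈ Metric.ball m (ρ / 2) →
      shiftAverage F ν t n + fderiv ℝ (shiftAverage F ν t) n v + c / 2 * ‖v‖ ^ 2 ≤
        shiftAverage F ν t (n + v) := by
  have hρ := h.ρ_pos
  have hc := h.c_pos
  have hM : 0 ≤ ∫ y, ‖y‖ ∂ν := integral_nonneg fun _ => norm_nonneg _
  set M := ∫ y, ‖y‖ ∂ν with hMdef
  refine ⟨ρ / (4 * (M + 1)), by positivity, fun t ht n hn v hv hnv => ?_⟩
  have htM : t * M ≤ ρ / 4 := by
    have h1 := (le_div_iff₀ (by positivity)).1 ht.2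
    have := ht.1
    nlinarith
  have hpt : ∀ y, F (n - t • y) + fderiv ℝ F (n - t • y) v + c * ‖v‖ ^ 2 *
      (1 - 2 * t / ρ * ‖y‖) ≤ F (n + v - t • y) := fun y => by
    have he : n + v - t • y = n - t • y + v := by abel
    rw [he]
    -- The indicator of `t * ‖y‖ < ρ / 2` is bounded below by `1 - 2 * t / ρ * ‖y‖`.
    rcases lt_or_ge (t * ‖y‖) (ρ / 2) with hlt | hge
    · have hball : ∀ u ∈ Metric.ball m (ρ / 2), u - t • y ∈ Metric.ball m ρ := fun u hu => by
        rw [mem_ball_iff_norm] at hu ⊢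
        have h1 : ‖u - t • y - m‖ ≤ ‖u - m‖ + ‖t • y‖ := by
          rw [sub_right_comm]
          exact norm_sub_le _ _
        rw [norm_smul, Real.norm_of_nonneg ht.1] at h1
        linarith
      have h1 := h.strong _ (hball n hn) v hv (he ▸ hball _ hnv)
      have h2 : c * ‖v‖ ^ 2 * (1 - 2 * t / ρ * ‖y‖) ≤ c * ‖v‖ ^ 2 := by
        refine mul_le_of_le_one_right (by positivity) ?_
        have : 0 ≤ 2 * t / ρ * ‖y‖ := by have := ht.1; positivity
        linarith
      linarith
    · have h1 := add_fderiv_le_of_convexOn h.convex (h.differentiable (n - t • y)) v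
      have h2 : c * ‖v‖ ^ 2 * (1 - 2 * t / ρ * ‖y‖) ≤ 0 := by
        refine mul_nonpos_of_nonneg_of_nonpos (by positivity) ?_
        have : 2 * t / ρ * ‖y‖ = (t * ‖y‖) / (ρ / 2) := by field_simp
        rw [this, sub_nonpos, le_div_iff₀ (by positivity)]
        linarith
      linarith
  have hi1 := h.integrable_shift t n
  have hi2 := (h.integrable_fderiv t n).apply_continuousLinearMap v
  have hi3 : Integrable (fun y : Fin d → ℝ => c * ‖v‖ ^ 2 * (1 - 2 * t / ρ * ‖y‖)) ν :=
    ((integrable_const _).sub (h.integrable_id.norm.const_mul _)).const_mul _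
  have hi12 : Integrable (fun y => F (n - t • y) + fderiv ℝ F (n - t • y) v) ν := hi1.add hi2
  have hmono := integral_mono (hi12.add hi3) (h.integrable_shift t (n + v)) hpt
  have he : ∫ y, (F (n - t • y) + fderiv ℝ F (n - t • y) v + c * ‖v‖ ^ 2 *
      (1 - 2 * t / ρ * ‖y‖)) ∂ν = shiftAverage F ν t n + fderiv ℝ (shiftAverage F ν t) n v +
        c * ‖v‖ ^ 2 * (1 - 2 * t / ρ * M) := by
    rw [integral_add hi12 hi3, integral_add hi1 hi2, integral_const_mul,
      integral_sub (integrable_const _) (h.integrable_id.norm.const_mul _), integral_const_mul,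
      h.fderiv_shiftAverage, ContinuousLinearMap.integral_apply (h.integrable_fderiv t n)]
    simp [shiftAverage, hMdef]
  have hmono' := he.symm.le.trans hmono
  change _ ≤ shiftAverage F ν t (n + v) at hmono'
  have h1 : 1 / 2 ≤ 1 - 2 * t / ρ * M := by
    have : 2 * t / ρ * M = 2 * (t * M) / ρ := by ring
    rw [this, le_sub_comm, div_le_iff₀ hρ]
    linarith
  have h2 : c * ‖v‖ ^ 2 * (1 / 2) ≤ c * ‖v‖ ^ 2 * (1 - 2 * t / ρ * M) := by gcongr
  linarith

end ShiftProblem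

/-! ### Minimal total under the constraint that a shift average be nonpositive -/

/-- The Lagrange multiplier rule for minimising `total` under the constraint `g n ≤ 0`. -/
lemma exists_fderiv_eq_neg_mul_total {d : ℕ} (hd : 0 < d) {g : (Fin d → ℝ) → ℝ}
    (hconv : ConvexOn ℝ univ g) (hdiff : Differentiable ℝ g) {n₀ : Fin d → ℝ} (hn₀ : g n₀ ≤ 0)
    (hmin : ∀ n, g n ≤ 0 → total n₀ ≤ total n) {p : Fin d → ℝ} (hp : g p < 0) :
    g n₀ = 0 ∧ ∃ κ > 0, ∀ v, fderiv ℝ g n₀ v = -(κ * total v) := by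
  have hd' : (0 : ℝ) < d := Nat.cast_pos.2 hd
  -- If `g n < 0`, lowering all components of `n` a little keeps the constraint.
  have hnonneg : ∀ n, total n ≤ total n₀ → 0 ≤ g n := fun n hn => by
    by_contra! hlt
    have hc : Tendsto (fun s : ℝ => g (n - s • 1)) (𝓝[>] 0) (𝓝 (g n)) := by
      have : Continuous fun s : ℝ => g (n - s • 1) := hdiff.continuous.comp (by fun_prop)
      simpa using (this.tendsto 0).mono_left (nhdsWithin_le_nhds (s := Ioi 0))
    obtain ⟨s, hs, hs0⟩ :=
      ((hc.eventually (gt_mem_nhds hlt)).and self_mem_nhdsWithin).exists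
    have h1 := hmin _ hs.le
    rw [map_sub, map_smul, total_one, smul_eq_mul] at h1
    have : 0 < s * d := mul_pos hs0 hd'
    linarith
  have hzero : g n₀ = 0 := le_antisymm hn₀ (hnonneg n₀ le_rfl)
  have hdir : ∀ v, total v ≤ 0 → 0 ≤ fderiv ℝ g n₀ v := fun v hv => by
    have hder : HasDerivAt (fun s : ℝ => g (n₀ + s • v)) (fderiv ℝ g n₀ v) 0 := by
      have h1 : HasDerivAt (fun s : ℝ => n₀ + s • v) v 0 := by
        simpa using ((hasDerivAt_id (0 : ℝ)).smul_const v).const_add n₀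
      have h2 : HasFDerivAt g (fderiv ℝ g n₀) (n₀ + (0 : ℝ) • v) := by
        simpa using (hdiff n₀).hasFDerivAt
      exact h2.comp_hasDerivAt 0 h1
    refine ge_of_tendsto hder.tendsto_slope_zero_right ?_
    filter_upwards [self_mem_nhdsWithin] with s hs
    have hs' : 0 < s := hs
    have h1 : 0 ≤ g (n₀ + s • v) := hnonneg _ (by
      rw [map_add, map_smul, smul_eq_mul]
      have := mul_nonpos_of_nonneg_of_nonpos hs'.le hv
      linarith)
    simp only [zero_add, zero_smul, add_zero, hzero, sub_zero, smul_eq_mul]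
    positivity
  have hgrad : ∀ v, fderiv ℝ g n₀ v = -(-(fderiv ℝ g n₀ 1) / d * total v) := fun v => by
    have h0 : total (v - (total v / d) • 1) = 0 := by
      rw [map_sub, map_smul, total_one, smul_eq_mul, div_mul_cancel₀ _ hd'.ne', sub_self]
    have h1 := hdir _ h0.le
    have h2 := hdir (-(v - (total v / d) • 1)) (by rw [map_neg, h0, neg_zero])
    rw [map_neg] at h2
    have h3 : fderiv ℝ g n₀ (v - (total v / d) • 1) = 0 := by linarith
    rw [map_sub, map_smul, smul_eq_mul] at h3
    rw [sub_eq_zero.1 h3]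
    field_simp
  refine ⟨hzero, _, lt_of_le_of_ne ?_ fun hκ => ?_, hgrad⟩
  · have h1 := hdir (-1) (by rw [map_neg, total_one]; linarith)
    rw [map_neg] at h1
    exact div_nonneg h1 hd'.le
  · have h1 := add_fderiv_le_of_convexOn hconv (hdiff n₀) (p - n₀)
    rw [hgrad, ← hκ, hzero, add_sub_cancel] at h1
    linarith

lemma neg_mul_total_le {d : ℕ} {g : (Fin d → ℝ) → ℝ}
    (hconv : ConvexOn ℝ univ g) (hdiff : Differentiable ℝ g) {N : Fin d → ℝ} (hN : g N = 0) {κ : ℝ}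
    (hκ : ∀ v, fderiv ℝ g N v = -(κ * total v)) (n : Fin d → ℝ) :
    -(κ * (total n - total N)) ≤ g n := by
  have h1 := add_fderiv_le_of_convexOn hconv (hdiff N) (n - N)
  rwa [hN, zero_add, hκ, map_sub, add_sub_cancel] at h1

namespace ShiftProblem

variable {d : ℕ} {F : (Fin d → ℝ) → ℝ} {ν : Measure (Fin d → ℝ)} [IsProbabilityMeasure ν]
  {m : Fin d → ℝ} {lam : ℝ} {D : (Fin d → ℝ) →L[ℝ] (Fin d → ℝ) →L[ℝ] ℝ} {c ρ : ℝ}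

lemma total_le_of_shiftAverage_nonpos (h : ShiftProblem F ν m lam D c ρ) {t : ℝ} {n : Fin d → ℝ}
    (hn : shiftAverage F ν t n ≤ 0) : total m + t * total (∫ y, y ∂ν) ≤ total n := by
  have h1 := (h.le_shiftAverage t n).trans hn
  rw [neg_nonpos] at h1
  have := nonneg_of_mul_nonneg_right h1 (inv_pos.2 h.lam_pos)
  linarith

/-- Since the gradient of `F` at `m` is constant over the components, only gradient increments
matter in the directions of total zero. -/
lemma fderiv_shiftAverage_apply (h : ShiftProblem F ν m lam D c ρ) (t : ℝ) (n : Fin d → ℝ)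
    {v : Fin d → ℝ} (hv : total v = 0) : fderiv ℝ (shiftAverage F ν t) n v =
      (∫ y, (fderiv ℝ F (n - t • y) - fderiv ℝ F m) ∂ν) v := by
  rw [h.fderiv_shiftAverage, integral_sub (h.integrable_fderiv t n) (integrable_const _),
    integral_const, probReal_univ, one_smul, sub_apply, h.fderiv_eq, hv]
  simp

lemma exists_abs_fderiv_shiftAverage_le (h : ShiftProblem F ν m lam D c ρ) {A : ℝ} (hA : 0 ≤ A) :
    ∃ K, ∀ t ∈ Icc (0 : ℝ) 1, ∀ a, ‖a‖ ≤ A → ∀ v, total v = 0 →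
      |fderiv ℝ (shiftAverage F ν t) (m + t • a) v| ≤ t * K * ‖v‖ := by
  obtain ⟨G, hG, hGle⟩ := h.exists_norm_fderiv_sub_le hA
  refine ⟨∫ y, G y ∂ν, fun t ht a ha v hv => ?_⟩
  rw [h.fderiv_shiftAverage_apply t _ hv, ← Real.norm_eq_abs]
  refine (ContinuousLinearMap.le_opNorm _ v).trans ?_
  gcongr
  rw [← integral_const_mul]
  exact norm_integral_le_of_norm_le (hG.const_mul t) (Eventually.of_forall (hGle t ht a ha))

/-- Moving from `m` at a velocity slightly larger than the mean shock satisfies the constraint. -/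
lemma eventually_shiftAverage_neg (h : ShiftProblem F ν m lam D c ρ) {ε : ℝ} (hε : 0 < ε) :
    ∀ᶠ t : ℝ in 𝓝[>] 0,
      shiftAverage F ν t (m + t • ((∫ y, y ∂ν) + ε • (1 : Fin d → ℝ))) < 0 := by
  set b := ∫ y, y ∂ν with hb
  set a := b + ε • (1 : Fin d → ℝ) with ha
  have hd' : (0 : ℝ) < d := Nat.cast_pos.2 h.dim_pos
  have hint : ∀ t : ℝ, Integrable (fun y => F (m + t • (a - y))) ν := fun t => by
    have he : (fun y => F (m + t • (a - y))) = fun y => F (m + t • a - t • y) := by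
      funext y
      rw [smul_sub, add_sub_assoc]
    rw [he]
    exact h.integrable_shift t _
  have hi : Integrable (fun y => a - y) ν := (integrable_const a).sub h.integrable_id
  have hlim : Tendsto (fun t : ℝ => ∫ y, t⁻¹ * F (m + t • (a - y)) ∂ν) (𝓝[>] 0)
      (𝓝 (∫ y, fderiv ℝ F m (a - y) ∂ν)) := by
    have hi' : Integrable (fun y => fderiv ℝ F m (a - y)) ν := (fderiv ℝ F m).integrable_comp hi
    refine tendsto_integral_filter_of_dominated_convergence
      (fun y => |F (m + (a - y))| + |fderiv ℝ F m (a - y)|) ?_ ?_ ?_ ?_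
    · exact Eventually.of_forall fun t => ((hint t).const_mul t⁻¹).1
    · filter_upwards [Ioc_mem_nhdsGT one_pos] with t ht
      refine Eventually.of_forall fun y => ?_
      have h1 := add_fderiv_le_of_convexOn h.convex (h.differentiable m) (t • (a - y))
      rw [h.map_eq_zero, zero_add, map_smul, smul_eq_mul] at h1
      have h2 := h.convex.2 (mem_univ m) (mem_univ (m + (a - y))) (sub_nonneg.2 ht.2) ht.1.le
        (sub_add_cancel 1 t)
      have he : (1 - t) • m + t • (m + (a - y)) = m + t • (a - y) := by module
      rw [he, h.map_eq_zero, smul_zero, zero_add, smul_eq_mul] at h2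
      have h3 := mul_le_mul_of_nonneg_left h1 (inv_pos.2 ht.1).le
      have h4 := mul_le_mul_of_nonneg_left h2 (inv_pos.2 ht.1).le
      rw [inv_mul_cancel_left₀ ht.1.ne'] at h3 h4
      rw [Real.norm_eq_abs]
      have h5 := neg_abs_le (fderiv ℝ F m (a - y))
      have h6 := le_abs_self (F (m + (a - y)))
      have h7 := abs_nonneg (fderiv ℝ F m (a - y))
      have h8 := abs_nonneg (F (m + (a - y)))
      rw [abs_le]
      constructor <;> linarith
    · have h1 : Integrable (fun y => F (m + (a - y))) ν := by simpa using hint 1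
      exact h1.abs.add hi'.abs
    · refine Eventually.of_forall fun y => ?_
      have hder : HasDerivAt (fun s : ℝ => F (m + s • (a - y))) (fderiv ℝ F m (a - y)) 0 := by
        have h1 : HasDerivAt (fun s : ℝ => m + s • (a - y)) (a - y) 0 := by
          simpa using ((hasDerivAt_id (0 : ℝ)).smul_const (a - y)).const_add m
        have h2 : HasFDerivAt F (fderiv ℝ F m) (m + (0 : ℝ) • (a - y)) := by
          simpa using (h.differentiable m).hasFDerivAt
        exact h2.comp_hasDerivAt 0 h1
      simpa [h.map_eq_zero] using hder.tendsto_slope_zero_right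
  have hval : ∫ y, fderiv ℝ F m (a - y) ∂ν = -(lam⁻¹ * (ε * d)) := by
    rw [ContinuousLinearMap.integral_comp_comm _ hi,
      integral_sub (integrable_const a) h.integrable_id, integral_const, probReal_univ, one_smul,
      ← hb, ha, add_sub_cancel_left, h.fderiv_eq, map_smul, total_one, smul_eq_mul]
  have hneg : -(lam⁻¹ * (ε * d)) < 0 := by
    have := h.lam_pos
    have : 0 < lam⁻¹ * (ε * d) := by positivity
    linarith
  rw [hval] at hlim
  filter_upwards [hlim.eventually (gt_mem_nhds hneg), self_mem_nhdsWithin] with t ht ht0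
  rw [integral_const_mul] at ht
  have h1 : ∫ y, F (m + t • (a - y)) ∂ν = shiftAverage F ν t (m + t • a) := by
    refine integral_congr_ae (Eventually.of_forall fun y => ?_)
    change F (m + t • (a - y)) = F (m + t • a - t • y)
    rw [smul_sub, add_sub_assoc]
  rw [h1] at ht
  exact neg_of_mul_neg_right ht (inv_pos.2 ht0).le

/-- For small `t` the points that satisfy the constraint at nearly minimal total lie near `m`: by
strong convexity the shift average is positive on a small sphere of each slice of constant total
around the curve `m + t • a`, hence, by convexity, also outside of it. -/
lemma exists_mem_ball_of_shiftAverage_nonpos (h : ShiftProblem F ν m lam D c ρ) {r : ℝ}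
    (hr : 0 < r) :
    ∃ t₂ > 0, ∀ t ∈ Icc (0 : ℝ) t₂, ∀ n, shiftAverage F ν t n ≤ 0 →
      total n ≤ total m + t * (total (∫ y, y ∂ν) + d) → n ∈ Metric.ball m r := by
  set b := ∫ y, y ∂ν with hb
  have hd' : (0 : ℝ) < d := Nat.cast_pos.2 h.dim_pos
  have hc := h.c_pos
  have hρ := h.ρ_pos
  have hlam := h.lam_pos
  set A := ‖b‖ + 1 with hA
  have hA0 : 0 < A := by positivity
  obtain ⟨K, hK⟩ := h.exists_abs_fderiv_shiftAverage_le hA0.le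
  obtain ⟨t₁, ht₁, hstrong⟩ := h.exists_shiftAverage_strong
  set r₁ := min (r / 2) (ρ / 8) with hr₁
  have hr₁0 : 0 < r₁ := by positivity
  have hr₁r : r₁ ≤ r / 2 := min_le_left _ _
  have hr₁ρ : r₁ ≤ ρ / 8 := min_le_right _ _
  set E := |K| * r₁ + lam⁻¹ * d with hE
  have hE0 : 0 < E := by positivity
  refine ⟨min (min 1 t₁) (min (r₁ / (2 * A)) (c * r₁ ^ 2 / (4 * E))), by positivity,
    fun t ht n hn htot => ?_⟩
  have ht0 : 0 ≤ t := ht.1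
  obtain ⟨⟨ht1, htt₁⟩, htA, htE⟩ :
      (t ≤ 1 ∧ t ≤ t₁) ∧ t ≤ r₁ / (2 * A) ∧ t ≤ c * r₁ ^ 2 / (4 * E) := by
    simpa [le_min_iff] using ht.2
  rw [le_div_iff₀ (by positivity)] at htA htE
  -- The point of the curve with the same total as `n`.
  obtain ⟨σ, hσ, htotσ⟩ : ∃ σ ∈ Icc (0 : ℝ) 1, total n = total m + t * (total b + σ * d) := by
    have hlow := h.total_le_of_shiftAverage_nonpos hn
    rcases ht0.eq_or_lt with rfl | htpos
    · refine ⟨0, by simp, ?_⟩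
      rw [zero_mul, add_zero] at htot hlow ⊢
      exact le_antisymm htot hlow
    · have htd : 0 < t * d := mul_pos htpos hd'
      refine ⟨(total n - total m - t * total b) / (t * d), ⟨div_nonneg (by linarith) htd.le,
        (div_le_one htd).2 (by linarith)⟩, ?_⟩
      field_simp
      ring
  set a := b + σ • (1 : Fin d → ℝ) with ha
  have haA : ‖a‖ ≤ A := by
    refine (norm_add_le _ _).trans (add_le_add_right ?_ _)
    rw [norm_smul, Real.norm_of_nonneg hσ.1]
    exact mul_le_one₀ hσ.2 (norm_nonneg _) norm_one_le
  set p := m + t • a with hp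
  have hpm : ‖p - m‖ ≤ t * A := by
    rw [hp, add_sub_cancel_left, norm_smul, Real.norm_of_nonneg ht0]
    gcongr
  have hptot : total p = total n := by
    rw [hp, ha, htotσ, map_add, map_smul, map_add, map_smul, total_one]
    simp only [smul_eq_mul]
  have hgp : -(t * (lam⁻¹ * d)) ≤ shiftAverage F ν t p := by
    refine le_trans ?_ (h.le_shiftAverage t p)
    rw [hptot, htotσ]
    have h1 : t * lam⁻¹ * d * σ ≤ t * lam⁻¹ * d := mul_le_of_le_one_right (by positivity) hσ.2
    calc -(t * (lam⁻¹ * d)) ≤ -(t * lam⁻¹ * d * σ) := by linarith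
      _ = _ := by rw [← hb]; ring
  have hv : total (n - p) = 0 := by rw [map_sub, hptot, sub_self]
  suffices hle : ‖n - p‖ ≤ r₁ by
    rw [mem_ball_iff_norm]
    have h1 : ‖n - m‖ ≤ ‖n - p‖ + ‖p - m‖ := norm_sub_le_norm_sub_add_norm_sub n p m
    linarith
  by_contra! hgt
  set θ := r₁ / ‖n - p‖ with hθ
  have hnp : 0 < ‖n - p‖ := hr₁0.trans hgt
  have hθ0 : 0 ≤ θ := by positivity
  have hθ1 : θ ≤ 1 := (div_le_one hnp).2 hgt.le
  have hv' : total (θ • (n - p)) = 0 := by rw [map_smul, hv, smul_zero]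
  have hnorm : ‖θ • (n - p)‖ = r₁ := by
    rw [norm_smul, Real.norm_of_nonneg hθ0, hθ, div_mul_cancel₀ _ hnp.ne']
  have h1 := hstrong t ⟨ht0, htt₁⟩ p (by rw [mem_ball_iff_norm]; linarith) (θ • (n - p)) hv' (by
    rw [mem_ball_iff_norm, add_sub_right_comm]
    have := norm_add_le (p - m) (θ • (n - p))
    linarith)
  have h2 := (abs_le.1 (hK t ⟨ht0, ht1⟩ a haA _ hv')).1
  rw [hnorm] at h1 h2
  have h3 := (h.convexOn_shiftAverage t).2 (mem_univ p) (mem_univ n) (sub_nonneg.2 hθ1) hθ0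
    (sub_add_cancel 1 θ)
  have he : (1 - θ) • p + θ • n = p + θ • (n - p) := by module
  rw [he, smul_eq_mul, smul_eq_mul] at h3
  have h4 : θ * shiftAverage F ν t n ≤ 0 := mul_nonpos_of_nonneg_of_nonpos hθ0 hn
  have h5 : -(t * (lam⁻¹ * d)) ≤ θ * shiftAverage F ν t p := by
    have h6 := mul_le_mul_of_nonneg_left hgp hθ0
    have h7 : θ * (t * (lam⁻¹ * d)) ≤ t * (lam⁻¹ * d) :=
      mul_le_of_le_one_left (by positivity) hθ1
    linarith
  have h8 : t * K * r₁ ≤ t * |K| * r₁ := by gcongr; exact le_abs_self K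
  have h9 : t * (4 * E) = 4 * (t * |K| * r₁ + t * (lam⁻¹ * d)) := by rw [hE]; ring
  have h10 : 0 < c * r₁ ^ 2 := by positivity
  change shiftAverage F ν t p + fderiv ℝ (shiftAverage F ν t) p (θ • (n - p)) +
    c / 2 * r₁ ^ 2 ≤ _ at h1
  change -(t * K * r₁) ≤ fderiv ℝ (shiftAverage F ν t) p (θ • (n - p)) at h2
  linarith

/-- Existence of a minimiser for small `t`, with its multiplier: by the localisation near `m` the
minimisation takes place over a compact set. -/
lemma exists_minimizer (h : ShiftProblem F ν m lam D c ρ) :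
    ∃ t₃ > 0, ∀ t ∈ Icc (0 : ℝ) t₃, ∃ N, shiftAverage F ν t N = 0 ∧
      ∃ κ > 0, ∀ v, fderiv ℝ (shiftAverage F ν t) N v = -(κ * total v) := by
  obtain ⟨t₂, ht₂, hball⟩ := h.exists_mem_ball_of_shiftAverage_nonpos one_pos
  obtain ⟨t₁, ht₁, hneg⟩ := mem_nhdsGT_iff_exists_Ioo_subset.1
    (h.eventually_shiftAverage_neg one_pos)
  have ht₁' : 0 < t₁ := ht₁
  refine ⟨min t₂ (t₁ / 2), by positivity, fun t ht => ?_⟩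
  have htt₂ : t ≤ t₂ := ht.2.trans (min_le_left _ _)
  have htt₁ : t ≤ t₁ / 2 := ht.2.trans (min_le_right _ _)
  rcases ht.1.eq_or_lt with rfl | ht0
  · rw [shiftAverage_zero]
    exact ⟨m, h.map_eq_zero, lam⁻¹, inv_pos.2 h.lam_pos, h.fderiv_eq⟩
  set p := m + t • ((∫ y, y ∂ν) + (1 : ℝ) • (1 : Fin d → ℝ)) with hp
  have hgp : shiftAverage F ν t p < 0 := hneg ⟨ht0, by linarith⟩
  have hptot : total p = total m + t * (total (∫ y, y ∂ν) + d) := by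
    rw [hp, map_add, map_smul, map_add, one_smul, total_one, smul_eq_mul]
  set S := {n | shiftAverage F ν t n ≤ 0 ∧ total n ≤ total p} with hS
  have hcts : Continuous (shiftAverage F ν t) := (h.differentiable_shiftAverage t).continuous
  have hScomp : IsCompact S := by
    refine Metric.isCompact_of_isClosed_isBounded ?_ ?_
    · exact (isClosed_le hcts continuous_const).inter
        (isClosed_le total.continuous continuous_const)
    · exact Metric.isBounded_ball.subset fun n hn =>
        hball t ⟨ht0.le, htt₂⟩ n hn.1 (hn.2.trans_eq hptot)
  obtain ⟨N, hN, hmin⟩ :=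
    hScomp.exists_isMinOn ⟨p, hgp.le, le_rfl⟩ total.continuous.continuousOn
  refine ⟨N, exists_fderiv_eq_neg_mul_total h.dim_pos (h.convexOn_shiftAverage t)
    (h.differentiable_shiftAverage t) hN.1 (fun n hn => ?_) hgp⟩
  rcases le_total (total n) (total p) with hle | hle
  · exact hmin ⟨hn, hle⟩
  · exact hN.2.trans hle

/-- For small `t` the minimiser exists and is unique. -/
lemma exists_unique_minimizer (h : ShiftProblem F ν m lam D c ρ) :
    ∃ t₀ > 0, ∀ t ∈ Icc (0 : ℝ) t₀, ∃ N, shiftAverage F ν t N = 0 ∧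
      (∃ κ > 0, ∀ v, fderiv ℝ (shiftAverage F ν t) N v = -(κ * total v)) ∧
      ∀ n, shiftAverage F ν t n ≤ 0 → total n ≤ total N → n = N := by
  obtain ⟨t₃, ht₃, hex⟩ := h.exists_minimizer
  obtain ⟨t₂, ht₂, hball⟩ :=
    h.exists_mem_ball_of_shiftAverage_nonpos (half_pos h.ρ_pos)
  obtain ⟨t₁, ht₁, hstrong⟩ := h.exists_shiftAverage_strong
  obtain ⟨t₄, ht₄, hneg⟩ := mem_nhdsGT_iff_exists_Ioo_subset.1
    (h.eventually_shiftAverage_neg one_pos)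
  have ht₄' : 0 < t₄ := ht₄
  refine ⟨min (min t₃ t₂) (min t₁ (t₄ / 2)), by positivity, fun t ht => ?_⟩
  obtain ⟨⟨htt₃, htt₂⟩, htt₁, htt₄⟩ : (t ≤ t₃ ∧ t ≤ t₂) ∧ t ≤ t₁ ∧ t ≤ t₄ / 2 := by
    simpa [le_min_iff] using ht.2
  obtain ⟨N, hN, κ, hκ, hgrad⟩ := hex t ⟨ht.1, htt₃⟩
  have hlow := neg_mul_total_le (h.convexOn_shiftAverage t) (h.differentiable_shiftAverage t)
    hN hgrad
  have hmin : ∀ n, shiftAverage F ν t n ≤ 0 → total N ≤ total n := fun n hn => by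
    have h1 := (hlow n).trans hn
    rw [neg_nonpos] at h1
    linarith [nonneg_of_mul_nonneg_right h1 hκ]
  have hNtot : total N ≤ total m + t * (total (∫ y, y ∂ν) + d) := by
    rcases ht.1.eq_or_lt with rfl | ht0
    · rw [zero_mul, add_zero]
      exact hmin m (by rw [shiftAverage_zero, h.map_eq_zero])
    · have h1 := hmin _ (hneg ⟨ht0, by linarith⟩ : _ ∈ {t : ℝ | _}).le
      rwa [map_add, map_smul, map_add, one_smul, total_one, smul_eq_mul] at h1
  refine ⟨N, hN, ⟨κ, hκ, hgrad⟩, fun n hn hle => ?_⟩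
  have htot : total (n - N) = 0 := by
    rw [map_sub, sub_eq_zero]
    exact le_antisymm hle (hmin n hn)
  have h1 := hstrong t ⟨ht.1, htt₁⟩ N (hball t ⟨ht.1, htt₂⟩ N hN.le hNtot) (n - N) htot (by
    rw [add_sub_cancel]
    exact hball t ⟨ht.1, htt₂⟩ n hn (hle.trans hNtot))
  rw [hN, hgrad, htot, add_sub_cancel] at h1
  have h2 : ‖n - N‖ ^ 2 ≤ 0 := by
    have := h.c_pos
    by_contra! hpos
    have : 0 < c / 2 * ‖n - N‖ ^ 2 := by positivity
    linarith
  have h3 : ‖n - N‖ = 0 := pow_eq_zero_iff two_ne_zero |>.1 (le_antisymm h2 (by positivity))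
  exact sub_eq_zero.1 (norm_eq_zero.1 h3)

/-- The minimisers move at the velocity of the mean shock. In each slice of constant total the
minimiser is compared with the point of that slice on a curve of velocity `∫ y, y ∂ν`: the averaged
gradient at that point is `o(t)` in the directions of total zero, so that strong convexity puts the
two within distance `o(t)`. -/
lemma tendsto_minimizer (h : ShiftProblem F ν m lam D c ρ) {N : ℝ → Fin d → ℝ}
    (hN : ∀ᶠ t in 𝓝[>] 0, shiftAverage F ν t (N t) = 0 ∧
      ∃ κ > 0, ∀ v, fderiv ℝ (shiftAverage F ν t) (N t) v = -(κ * total v)) :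
    Tendsto (fun t : ℝ => t⁻¹ • (N t - m)) (𝓝[>] 0) (𝓝 (∫ y, y ∂ν)) := by
  set b := ∫ y, y ∂ν with hb
  have hd' : (0 : ℝ) < d := Nat.cast_pos.2 h.dim_pos
  have hc := h.c_pos
  have hρ := h.ρ_pos
  have hpos : ∀ᶠ t : ℝ in 𝓝[>] 0, 0 < t := self_mem_nhdsWithin
  have hlow : ∀ᶠ t : ℝ in 𝓝[>] 0, ∃ κ > 0, ∀ n,
      -(κ * (total n - total (N t))) ≤ shiftAverage F ν t n := hN.mono fun t ht => by
    obtain ⟨h0, κ, hκ, hgrad⟩ := ht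
    exact ⟨κ, hκ, neg_mul_total_le (h.convexOn_shiftAverage t) (h.differentiable_shiftAverage t)
      h0 hgrad⟩
  set σ : ℝ → ℝ := fun t => (total (N t) - total m - t * total b) / (t * d) with hσ
  have hσ0 : Tendsto σ (𝓝[>] 0) (𝓝 0) := by
    rw [Metric.tendsto_nhds]
    intro ε hε
    filter_upwards [hpos, hN, hlow, h.eventually_shiftAverage_neg (half_pos hε)] with t ht hNt hlt
      hneg
    have htd : 0 < t * d := mul_pos ht hd'
    obtain ⟨κ, hκ, hκle⟩ := hlt
    have h1 := h.total_le_of_shiftAverage_nonpos hNt.1.le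
    have h2 := (hκle _).trans hneg.le
    rw [neg_nonpos] at h2
    have h3 := nonneg_of_mul_nonneg_right h2 hκ
    rw [map_add, map_smul, map_add, map_smul, total_one, smul_eq_mul, smul_eq_mul] at h3
    rw [dist_zero_right, Real.norm_of_nonneg (div_nonneg (by linarith) htd.le), div_lt_iff₀ htd]
    have h4 : 0 < ε * (t * d) := by positivity
    linarith
  set a : ℝ → Fin d → ℝ := fun t => b + σ t • (1 : Fin d → ℝ) with ha
  have hatend : Tendsto a (𝓝[>] 0) (𝓝 b) := by
    simpa using (hσ0.smul_const (1 : Fin d → ℝ)).const_add b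
  set τ : ℝ → ℝ := fun t =>
    ‖∫ y, t⁻¹ • (fderiv ℝ F (m + t • a t - t • y) - fderiv ℝ F m) ∂ν‖ with hτ
  have hτ0 : Tendsto τ (𝓝[>] 0) (𝓝 0) := by
    simpa using (h.tendsto_integral_fderiv_sub hatend).norm
  obtain ⟨t₂, ht₂, hball⟩ :=
    h.exists_mem_ball_of_shiftAverage_nonpos (half_pos h.ρ_pos)
  obtain ⟨t₁, ht₁, hstrong⟩ := h.exists_shiftAverage_strong
  have hpball : ∀ᶠ t in 𝓝[>] 0, m + t • a t ∈ Metric.ball m (ρ / 2) := by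
    have h1 : Tendsto (fun t : ℝ => t) (𝓝[>] 0) (𝓝 0) := nhdsWithin_le_nhds
    have h2 : Tendsto (fun t => m + t • a t) (𝓝[>] 0) (𝓝 m) := by
      simpa using (h1.smul hatend).const_add m
    exact h2.eventually (Metric.ball_mem_nhds m (half_pos hρ))
  have hdist : ∀ᶠ t in 𝓝[>] 0, ‖t⁻¹ • (N t - m) - a t‖ ≤ 2 / c * τ t := by
    filter_upwards [hpos, hN, hlow, hpball, h.eventually_shiftAverage_neg one_pos,
      Ioc_mem_nhdsGT ht₁, Ioc_mem_nhdsGT ht₂] with t ht hNt hlt hpb hneg htt₁ htt₂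
    obtain ⟨κ, hκ, hκle⟩ := hlt
    set p := m + t • a t with hp
    have hptot : total p = total (N t) := by
      rw [hp, ha, map_add, map_smul, map_add, map_smul, total_one, smul_eq_mul, smul_eq_mul, hσ]
      field_simp
      ring
    have hv : total (N t - p) = 0 := by rw [map_sub, hptot, sub_self]
    have hgp : 0 ≤ shiftAverage F ν t p := by simpa [hptot, -total_apply] using hκle p
    have hNtot : total (N t) ≤ total m + t * (total b + d) := by
      have h2 := (hκle _).trans hneg.le
      rw [neg_nonpos] at h2
      have h3 := nonneg_of_mul_nonneg_right h2 hκ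
      rw [map_add, map_smul, map_add, one_smul, total_one, smul_eq_mul] at h3
      linarith
    have h1 := hstrong t ⟨ht.le, htt₁.2⟩ p hpb (N t - p) hv (by
      rw [add_sub_cancel]
      exact hball t ⟨ht.le, htt₂.2⟩ (N t) hNt.1.le hNtot)
    rw [add_sub_cancel, hNt.1, h.fderiv_shiftAverage_apply t p hv] at h1
    have h2 : -(t * τ t * ‖N t - p‖) ≤
        (∫ y, (fderiv ℝ F (p - t • y) - fderiv ℝ F m) ∂ν) (N t - p) := by
      have h3 : ‖∫ y, (fderiv ℝ F (p - t • y) - fderiv ℝ F m) ∂ν‖ = t * τ t := by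
        rw [hτ]
        simp only
        rw [integral_smul, norm_smul, norm_inv, Real.norm_of_nonneg ht.le,
          mul_inv_cancel_left₀ ht.ne']
      rw [← h3]
      have h4 : ‖(∫ y, (fderiv ℝ F (p - t • y) - fderiv ℝ F m) ∂ν) (N t - p)‖ ≤
        ‖∫ y, (fderiv ℝ F (p - t • y) - fderiv ℝ F m) ∂ν‖ * ‖N t - p‖ :=
        ContinuousLinearMap.le_opNorm _ _
      exact (abs_le.1 h4).1
    have h5 : ‖N t - p‖ ≤ 2 / c * (t * τ t) := by
      rcases (norm_nonneg (N t - p)).eq_or_lt with h0 | h0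
      · rw [← h0]
        have : 0 ≤ τ t := norm_nonneg _
        positivity
      · have h6 : c / 2 * ‖N t - p‖ ≤ t * τ t := by
          refine le_of_mul_le_mul_right ?_ h0
          linarith
        calc ‖N t - p‖ = 2 / c * (c / 2 * ‖N t - p‖) := by field_simp
          _ ≤ 2 / c * (t * τ t) := by gcongr
    have he : t⁻¹ • (N t - m) - a t = t⁻¹ • (N t - p) := by
      rw [hp, ← sub_sub (N t) m, smul_sub t⁻¹ (N t - m), smul_smul, inv_mul_cancel₀ ht.ne',
        one_smul]
    rw [he, norm_smul, norm_inv, Real.norm_of_nonneg ht.le, inv_mul_le_iff₀ ht]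
    linarith
  have hdiff : Tendsto (fun t : ℝ => t⁻¹ • (N t - m) - a t) (𝓝[>] 0) (𝓝 0) :=
    squeeze_zero_norm' hdist (by simpa using hτ0.const_mul (2 / c))
  simpa using hdiff.add hatend

end ShiftProblem

/-! ### The Orlicz heart of a loss function -/

section OrliczHeart

variable {d : ℕ} {Ω : Type*} [MeasurableSpace Ω] {P : Measure Ω} {ℓ : (Fin d → ℝ) → ℝ}
  {X Y : Ω → Fin d → ℝ}

lemma IsLossFunction.apply_add_le (hℓ : IsLossFunction ℓ) (u v : Fin d → ℝ) :
    ℓ (u + v) ≤ 1 / 2 * ℓ ((2 : ℝ) • u) + 1 / 2 * ℓ ((2 : ℝ) • v) := by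
  have h := hℓ.convex.2 (mem_univ ((2 : ℝ) • u)) (mem_univ ((2 : ℝ) • v))
    (by norm_num : (0 : ℝ) ≤ 1 / 2) (by norm_num : (0 : ℝ) ≤ 1 / 2) (by norm_num)
  simpa [smul_smul] using h

lemma measurable_loss_abs_smul (hc : Continuous ℓ) (r : ℝ) :
    Measurable (fun x : Fin d → ℝ => ℓ |r • x|) :=
  (hc.comp (continuous_pi fun k => (by fun_prop : Continuous fun x : Fin d → ℝ =>
    |r • x k|))).measurable

lemma MemOrliczHeart.add [IsFiniteMeasure P] (hℓ : IsLossFunction ℓ) (hc : Continuous ℓ)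
    (hX : MemOrliczHeart ℓ P X) (hY : MemOrliczHeart ℓ P Y) : MemOrliczHeart ℓ P (X + Y) := by
  refine ⟨hX.1.add hY.1, fun r hr => ?_⟩
  have hmeas : AEStronglyMeasurable (fun ω => ℓ |r • (X + Y) ω|) P :=
    ((measurable_loss_abs_smul hc r).comp_aemeasurable (hX.1.add hY.1)).aestronglyMeasurable
  refine integrable_of_le_of_le hmeas (Eventually.of_forall fun ω => ?_)
    (Eventually.of_forall fun ω => ?_) (integrable_const (ℓ 0))
    (((hX.2 (2 * r) (by positivity)).const_mul (1 / 2)).add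
      ((hY.2 (2 * r) (by positivity)).const_mul (1 / 2)))
  · exact hℓ.increasing (abs_nonneg _)
  · have h1 : |r • (X + Y) ω| ≤ |r • X ω| + |r • Y ω| := by
      rw [Pi.add_apply, smul_add]
      exact abs_add_le _ _
    refine (hℓ.increasing h1).trans ((hℓ.apply_add_le _ _).trans_eq ?_)
    have h2 : ∀ x : Fin d → ℝ, (2 : ℝ) • |r • x| = |(2 * r) • x| := fun x => by
      funext k
      simp [abs_mul, mul_assoc]
    simp only [h2, Pi.add_apply]

lemma MemOrliczHeart.smul (hX : MemOrliczHeart ℓ P X) (t : ℝ) : MemOrliczHeart ℓ P (t • X) := by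
  refine ⟨hX.1.const_smul t, fun r hr => ?_⟩
  have h : ∀ x : Fin d → ℝ, |r • t • x| = |(r * |t|) • x| := fun x => by
    funext k
    simp [abs_mul, mul_assoc]
  simpa only [Pi.smul_apply, h] using hX.2 (r * |t|) (by positivity)

lemma memOrliczHeart_const [IsFiniteMeasure P] (u : Fin d → ℝ) :
    MemOrliczHeart ℓ P (fun _ => u) :=
  ⟨aemeasurable_const, fun _ _ => integrable_const _⟩

lemma MemOrliczHeart.integrable_loss [IsFiniteMeasure P] (hℓ : IsLossFunction ℓ)
    (hc : Continuous ℓ) (hX : MemOrliczHeart ℓ P X) : Integrable (fun ω => ℓ (X ω)) P := by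
  have habs : Integrable (fun ω => ℓ |X ω|) P := by simpa using hX.2 1 zero_le_one
  refine integrable_of_le_of_le (hc.measurable.comp_aemeasurable hX.1).aestronglyMeasurable
    (Eventually.of_forall fun ω => ?_) (Eventually.of_forall fun ω => ?_)
    (((integrable_const (2 * ℓ 0))).sub habs) habs
  · have h1 := hℓ.apply_add_le ((1 / 2 : ℝ) • |X ω|) (-((1 / 2 : ℝ) • |X ω|))
    rw [add_neg_cancel, smul_neg, smul_smul] at h1
    norm_num at h1
    have h2 : ℓ (-|X ω|) ≤ ℓ (X ω) := hℓ.increasing fun k => neg_abs_le (X ω k)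
    simp only [Pi.sub_apply]
    linarith
  · exact hℓ.increasing (le_abs_self (X ω))

lemma MemOrliczHeart.integrable [IsFiniteMeasure P] (hℓ : IsLossFunction ℓ)
    (hX : MemOrliczHeart ℓ P X) : Integrable X P := by
  obtain ⟨c, hc⟩ := hℓ.risk_averse
  have habs : Integrable (fun ω => ℓ |X ω| + c) P := by
    simpa using (hX.2 1 zero_le_one).add (integrable_const c)
  refine habs.mono' hX.1.aestronglyMeasurable (Eventually.of_forall fun ω => ?_)
  have h1 : ∑ k, |X ω| k ≤ ℓ |X ω| + c := by linarith [hc |X ω|]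
  have h0 : ∀ k ∈ Finset.univ, 0 ≤ |X ω| k := fun k _ => abs_nonneg (X ω k)
  refine ((pi_norm_le_iff_of_nonneg (Finset.sum_nonneg h0)).2 fun k => ?_).trans h1
  exact Finset.single_le_sum h0 (Finset.mem_univ k)

/-- Averaging over the cyclic shifts of the components: permutation invariance allows all components
to be replaced by the largest one, at the cost of a factor `d`. -/
lemma apply_norm_smul_one_le (hℓ : IsLossFunction ℓ) (hperm : PermutationInvariant ℓ)
    (x : Fin d → ℝ) : ℓ (‖x‖ • 1) ≤ ℓ |(d : ℝ) • x| := by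
  rcases Nat.eq_zero_or_pos d with rfl | hd
  · exact (congrArg ℓ (Subsingleton.elim _ _)).le
  have : NeZero d := ⟨hd.ne'⟩
  have hd' : (0 : ℝ) < d := Nat.cast_pos.2 hd
  have h1 : ‖x‖ • (1 : Fin d → ℝ) ≤
      ∑ j : Fin d, (d : ℝ)⁻¹ • fun k => |(d : ℝ) • x| (Equiv.addRight j k) := fun k => by
    have h2 : (∑ j : Fin d, (d : ℝ)⁻¹ • fun k => |(d : ℝ) • x| (Equiv.addRight j k)) k =
        ∑ j, |x j| := by
      rw [Finset.sum_apply, ← Equiv.sum_comp (Equiv.addLeft k) fun j => |x j|]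
      refine Finset.sum_congr rfl fun j _ => ?_
      simp [abs_mul, hd'.ne']
    rw [h2, Pi.smul_apply, Pi.one_apply, smul_eq_mul, mul_one]
    exact (pi_norm_le_iff_of_nonneg (Finset.sum_nonneg fun _ _ => abs_nonneg _)).2 fun i =>
      Finset.single_le_sum (f := fun j => |x j|) (fun _ _ => abs_nonneg _) (Finset.mem_univ i)
  have h3 := hℓ.convex.map_sum_le (t := Finset.univ) (w := fun _ : Fin d => (d : ℝ)⁻¹)
    (p := fun j k => |(d : ℝ) • x| (Equiv.addRight j k)) (fun _ _ => (inv_pos.2 hd').le)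
    (by simp [hd'.ne']) (fun _ _ => mem_univ _)
  refine (hℓ.increasing h1).trans (h3.trans_eq ?_)
  simp only [hperm (Equiv.addRight _) |(d : ℝ) • x|]
  simp [hd'.ne']

lemma MemOrliczHeart.norm_smul_one [IsFiniteMeasure P] (hℓ : IsLossFunction ℓ)
    (hc : Continuous ℓ) (hperm : PermutationInvariant ℓ) (hX : MemOrliczHeart ℓ P X) :
    MemOrliczHeart ℓ P (fun ω => ‖X ω‖ • 1) := by
  have hmeas : AEMeasurable (fun ω => ‖X ω‖ • (1 : Fin d → ℝ)) P :=
    (by fun_prop : Measurable fun x : Fin d → ℝ => ‖x‖ • (1 : Fin d → ℝ)).comp_aemeasurable hX.1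
  refine ⟨hmeas, fun r hr => ?_⟩
  refine integrable_of_le_of_le
    ((measurable_loss_abs_smul hc r).comp_aemeasurable hmeas).aestronglyMeasurable
    (Eventually.of_forall fun ω => ?_) (Eventually.of_forall fun ω => ?_) (integrable_const (ℓ 0))
    (hX.2 (d * r) (by positivity))
  · exact hℓ.increasing (abs_nonneg _)
  · have h1 := apply_norm_smul_one_le hℓ hperm (r • X ω)
    rw [norm_smul, Real.norm_of_nonneg hr, smul_smul] at h1
    have h2 : |r • ‖X ω‖ • (1 : Fin d → ℝ)| = (r * ‖X ω‖) • 1 := by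
      funext k
      simp [abs_mul, abs_of_nonneg hr]
    change ℓ |r • ‖X ω‖ • (1 : Fin d → ℝ)| ≤ _
    rwa [h2]

end OrliczHeart

/-! ### Saddle points -/

lemma isSaddlePoint_iff {d : ℕ} {Ω : Type*} [MeasurableSpace Ω] {ℓ : (Fin d → ℝ) → ℝ}
    {P : Measure Ω} {X : Ω → Fin d → ℝ} (hconv : ConvexOn ℝ univ (expectedLoss ℓ P X))
    (hdiff : Differentiable ℝ (expectedLoss ℓ P X)) {m : Fin d → ℝ} {lam : ℝ} :
    IsSaddlePoint ℓ P X m lam ↔ 0 < lam ∧ expectedLoss ℓ P X m = 0 ∧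
      ∀ v, fderiv ℝ (expectedLoss ℓ P X) m v = -(lam⁻¹ * total v) := by
  constructor
  · rintro ⟨hlam, hm, hl⟩
    refine ⟨hlam, ?_, fun v => ?_⟩
    · have h1 := hl (2 * lam) (by positivity)
      have h2 := hl (lam / 2) (by positivity)
      simp only [lagrangian] at h1 h2
      nlinarith
    · have hmin : IsLocalMin (fun n => total n + lam * expectedLoss ℓ P X n) m :=
        Eventually.of_forall fun n => by simpa [lagrangian] using hm n
      have h1 := hmin.hasFDerivAt_eq_zero
        (total.hasFDerivAt.add ((hdiff m).hasFDerivAt.const_mul lam))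
      have h2 : total v + lam * fderiv ℝ (expectedLoss ℓ P X) m v = 0 :=
        congrArg (fun T : (Fin d → ℝ) →L[ℝ] ℝ => T v) h1
      field_simp
      linarith
  · rintro ⟨hlam, h0, hgrad⟩
    refine ⟨hlam, fun n => ?_, fun l _ => by simp [lagrangian, h0]⟩
    have h1 := mul_le_mul_of_nonneg_left (neg_mul_total_le hconv hdiff h0 hgrad n) hlam.le
    have h2 : lam * -(lam⁻¹ * (total n - total m)) = total m - total n := by
      field_simp
      ring
    rw [h2, total_apply, total_apply] at h1
    simp only [lagrangian, h0, mul_zero, add_zero]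
    linarith

/-! ### The expected Hessian as a bilinear form -/

section Hessian

-- `E →L[ℝ] E →L[ℝ] ℝ` finds its `ContinuousENorm` instance only at a greater search depth.
set_option maxSynthPendingDepth 6

variable {d : ℕ} {Ω : Type*} [MeasurableSpace Ω] {P : Measure Ω} {ℓ : (Fin d → ℝ) → ℝ}
  {X : Ω → Fin d → ℝ}

/-- The bilinear form `(v, w) ↦ ∑ i, ∑ j, A i j * v i * w j` of a matrix `A`. -/
noncomputable def bilinOfMatrix (A : Matrix (Fin d) (Fin d) ℝ) :
    (Fin d → ℝ) →L[ℝ] (Fin d → ℝ) →L[ℝ] ℝ :=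
  ∑ i, ∑ j, A i j • (ContinuousLinearMap.proj (R := ℝ) (φ := fun _ : Fin d => ℝ) i).smulRight
    (ContinuousLinearMap.proj (R := ℝ) (φ := fun _ : Fin d => ℝ) j)

lemma bilinOfMatrix_apply (A : Matrix (Fin d) (Fin d) ℝ) (v w : Fin d → ℝ) :
    bilinOfMatrix A v w = ∑ i, ∑ j, A i j * (v i * w j) := by
  simp [bilinOfMatrix]

lemma bilinOfMatrix_apply_single (B : (Fin d → ℝ) →L[ℝ] (Fin d → ℝ) →L[ℝ] ℝ) :
    bilinOfMatrix (Matrix.of fun i j => B (Pi.single i 1) (Pi.single j 1)) = B := by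
  ext v w
  rw [bilinOfMatrix_apply]
  conv_rhs => rw [pi_eq_sum_univ' v, pi_eq_sum_univ' w]
  simp only [map_sum, map_smul, sum_apply, smul_apply, smul_eq_mul,
    Finset.mul_sum, Matrix.of_apply]
  rw [Finset.sum_comm]
  refine Finset.sum_congr rfl fun j _ => Finset.sum_congr rfl fun i _ => ?_
  ring

lemma fderiv_comp_neg {E G : Type*} [NormedAddCommGroup E] [NormedSpace ℝ E]
    [NormedAddCommGroup G] [NormedSpace ℝ G] (f : E → G) (u : E) :
    fderiv ℝ (fun x => f (-x)) u = -fderiv ℝ f (-u) := by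
  have h := (ContinuousLinearEquiv.neg ℝ (M := E)).comp_right_fderiv (f := f) (x := u)
  refine h.trans ?_
  ext v
  simp

lemma sndFDeriv_comp_neg (u : Fin d → ℝ) : fderiv ℝ (fderiv ℝ fun x => ℓ (-x)) u =
    bilinOfMatrix (hessian ℓ (-u)) := by
  have h1 : (fderiv ℝ fun x => ℓ (-x)) = fun u => -fderiv ℝ ℓ (-u) := by
    funext u
    exact fderiv_comp_neg ℓ u
  have h2 : fderiv ℝ (fun u => -fderiv ℝ ℓ (-u)) u = fderiv ℝ (fderiv ℝ ℓ) (-u) := by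
    rw [fderiv_fun_neg, fderiv_comp_neg (fderiv ℝ ℓ), neg_neg]
  rw [h1, h2]
  exact (bilinOfMatrix_apply_single _).symm

lemma measurable_hessian (i j : Fin d) : Measurable (fun x => hessian ℓ x i j) :=
  (ContinuousLinearMap.measurable_apply (Pi.single j 1 : Fin d → ℝ)).comp
    ((ContinuousLinearMap.measurable_apply (Pi.single i 1 : Fin d → ℝ)).comp
      (measurable_fderiv ℝ (fderiv ℝ ℓ)))

lemma integrable_sndFDeriv_of_hessian (hX : AEMeasurable X P) {n : Fin d → ℝ}
    (h : ∀ i j, Integrable (fun ω => hessian ℓ (X ω - n) i j) P) :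
    Integrable (fun x => fderiv ℝ (fderiv ℝ fun x => ℓ (-x)) (n - x)) (P.map X) ∧
      ∫ x, fderiv ℝ (fderiv ℝ fun x => ℓ (-x)) (n - x) ∂(P.map X) =
        bilinOfMatrix (expectedHessian ℓ P X n) := by
  have hmeas : ∀ i j, Measurable (fun x => hessian ℓ (x - n) i j) := fun i j =>
    (measurable_hessian i j).comp (measurable_id.sub_const n)
  have hint : ∀ i j, Integrable (fun x => hessian ℓ (x - n) i j) (P.map X) := fun i j =>
    (integrable_map_measure (hmeas i j).aestronglyMeasurable hX).2 (h i j)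
  have hval : ∀ i j, ∫ x, hessian ℓ (x - n) i j ∂(P.map X) = expectedHessian ℓ P X n i j :=
    fun i j => integral_map hX (hmeas i j).aestronglyMeasurable
  simp only [sndFDeriv_comp_neg, neg_sub, bilinOfMatrix]
  refine ⟨integrable_finsetSum _ fun i _ => integrable_finsetSum _ fun j _ =>
    (hint i j).smul_const _, ?_⟩
  rw [integral_finsetSum _ fun i _ => integrable_finsetSum _ fun j _ => (hint i j).smul_const _]
  refine Finset.sum_congr rfl fun i _ => ?_
  rw [integral_finsetSum _ fun j _ => (hint i j).smul_const _]
  refine Finset.sum_congr rfl fun j _ => ?_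
  rw [integral_smul_const, hval]

lemma continuousAt_bilinOfMatrix {f : (Fin d → ℝ) → Matrix (Fin d) (Fin d) ℝ} {m : Fin d → ℝ}
    (hf : ContinuousAt f m) : ContinuousAt (fun n => bilinOfMatrix (f n)) m := by
  have hcont : Continuous (bilinOfMatrix (d := d)) := by
    unfold bilinOfMatrix
    refine continuous_finsetSum _ fun i _ => continuous_finsetSum _ fun j _ => ?_
    exact Continuous.smul (continuous_id.matrix_elem i j) continuous_const
  exact hcont.continuousAt.comp hf

/-- A vector of total zero in the kernel of the expected Hessian gives one in the kernel of the
bordered matrix, hence vanishes. -/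
lemma eq_zero_of_expectedHessian_mulVec_eq_zero {m : Fin d → ℝ} {lam : ℝ}
    (hM : IsUnit (saddleMatrix ℓ P X m lam).det) {v : Fin d → ℝ} (hv : total v = 0)
    (hH : (expectedHessian ℓ P X m).mulVec v = 0) : v = 0 := by
  have h0 : (saddleMatrix ℓ P X m lam).mulVec (Sum.elim v 0) = 0 := by
    rw [saddleMatrix, Matrix.fromBlocks_mulVec]
    have h1 : (Matrix.of fun (_ : Unit) (_ : Fin d) => (1 : ℝ)).mulVec v = 0 := by
      funext k
      simpa [Matrix.mulVec, dotProduct] using hv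
    simp [Matrix.smul_mulVec, hH, h1]
  have h1 := Matrix.eq_zero_of_mulVec_eq_zero hM.ne_zero h0
  funext k
  exact congrFun h1 (Sum.inl k)

end Hessian

/-! ### Independent shocks -/

section Shock

variable {d : ℕ} {Ω : Type*} [MeasurableSpace Ω] {P : Measure Ω}
  {ℓ : (Fin d → ℝ) → ℝ} {X Y : Ω → Fin d → ℝ}

lemma expectedLoss_eq_integral_map (hℓ : Continuous ℓ) (hX : AEMeasurable X P) :
    expectedLoss ℓ P X = fun n => ∫ x, ℓ (-(n - x)) ∂(P.map X) := by
  funext n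
  have hcont : Continuous fun x => ℓ (-(n - x)) := hℓ.comp (by fun_prop)
  rw [integral_map hX hcont.aestronglyMeasurable]
  simp [expectedLoss]

lemma convexOn_comp_neg (hℓ : IsLossFunction ℓ) : ConvexOn ℝ univ (fun x => ℓ (-x)) := by
  have h := hℓ.convex.comp_linearMap (-LinearMap.id : (Fin d → ℝ) →ₗ[ℝ] (Fin d → ℝ))
  rw [preimage_univ] at h
  exact h.congr fun x _ => by simp

lemma antitone_comp_neg (hℓ : IsLossFunction ℓ) : Antitone (fun x => ℓ (-x)) :=
  fun _ _ hxy => hℓ.increasing (neg_le_neg hxy)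

lemma MemOrliczHeart.integrable_loss_map [IsProbabilityMeasure P] (hℓ : IsLossFunction ℓ)
    (hc : Continuous ℓ) (hX : MemOrliczHeart ℓ P X) (n : Fin d → ℝ) :
    Integrable (fun x => ℓ (-(n - x))) (P.map X) := by
  have hcont : Continuous fun x => ℓ (-(n - x)) := hc.comp (by fun_prop)
  rw [integrable_map_measure hcont.aestronglyMeasurable hX.1]
  have h := (hX.add hℓ hc (memOrliczHeart_const (-n))).integrable_loss hℓ hc
  refine h.congr (Eventually.of_forall fun ω => ?_)
  simp [← sub_eq_add_neg]

/-- Expectations of functions of two independent variables, one of them transformed by `f`, as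
iterated integrals of the expected loss. -/
lemma integral_expectedLoss_map [IsProbabilityMeasure P] (hℓ : IsLossFunction ℓ) (hc : Continuous ℓ)
    (hX : MemOrliczHeart ℓ P X) (hY : AEMeasurable Y P) (hindep : IndepFun X Y P)
    {f : (Fin d → ℝ) → Fin d → ℝ} (hf : Measurable f)
    (hfY : MemOrliczHeart ℓ P (fun ω => f (Y ω))) (n : Fin d → ℝ) :
    Integrable (fun y => expectedLoss ℓ P X (n - f y)) (P.map Y) ∧
      ∫ y, expectedLoss ℓ P X (n - f y) ∂(P.map Y) =
        ∫ ω, ℓ (X ω + f (Y ω) - n) ∂P := by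
  have hXY : AEMeasurable (fun ω => (X ω, Y ω)) P := hX.1.prodMk hY
  have : IsProbabilityMeasure (P.map X) := Measure.isProbabilityMeasure_map hX.1
  have : IsProbabilityMeasure (P.map Y) := Measure.isProbabilityMeasure_map hY
  have hlaw : P.map (fun ω => (X ω, Y ω)) = (P.map X).prod (P.map Y) :=
    (indepFun_iff_map_prod_eq_prod_map_map hX.1 hY).1 hindep
  have hmeas : Measurable (fun p : (Fin d → ℝ) × (Fin d → ℝ) => ℓ (p.1 + f p.2 - n)) :=
    hc.measurable.comp (by fun_prop)
  have hP : Integrable (fun ω => ℓ (X ω + f (Y ω) - n)) P := by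
    have h := ((hX.add hℓ hc hfY).add hℓ hc (memOrliczHeart_const (-n))).integrable_loss hℓ hc
    refine h.congr (Eventually.of_forall fun ω => ?_)
    simp [← sub_eq_add_neg]
  have hprod : Integrable (fun p : (Fin d → ℝ) × (Fin d → ℝ) => ℓ (p.1 + f p.2 - n))
      ((P.map X).prod (P.map Y)) := by
    rw [← hlaw]
    exact (integrable_map_measure hmeas.aestronglyMeasurable hXY).2 hP
  have hinner : ∀ y, ∫ x, ℓ (x + f y - n) ∂(P.map X) = expectedLoss ℓ P X (n - f y) := fun y => by
    rw [expectedLoss_eq_integral_map hc hX.1]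
    refine integral_congr_ae (Eventually.of_forall fun x => ?_)
    change ℓ _ = ℓ _
    congr 1
    abel
  refine ⟨hprod.integral_prod_right.congr (Eventually.of_forall hinner), ?_⟩
  simp only [← hinner]
  rw [← integral_prod_symm (fun p : (Fin d → ℝ) × (Fin d → ℝ) => ℓ (p.1 + f p.2 - n)) hprod, ← hlaw,
    integral_map hXY hmeas.aestronglyMeasurable]

lemma expectedLoss_add_smul [IsProbabilityMeasure P] (hℓ : IsLossFunction ℓ) (hc : Continuous ℓ)
    (hX : MemOrliczHeart ℓ P X) (hY : MemOrliczHeart ℓ P Y) (hindep : IndepFun X Y P) (t : ℝ) :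
    expectedLoss ℓ P (X + t • Y) = shiftAverage (expectedLoss ℓ P X) (P.map Y) t := by
  funext n
  exact (integral_expectedLoss_map hℓ hc hX hY.1 hindep (f := fun y => t • y) (by fun_prop)
    (hY.smul t) n).2.symm

-- `E →L[ℝ] E →L[ℝ] ℝ` finds its `ContinuousENorm` instance only at a greater search depth.
set_option maxSynthPendingDepth 6 in
/-- At a saddle point of `X` with regular expected Hessian and nonsingular bordered matrix, the
expected loss of `X` together with an independent shock `Y` satisfies all that the analysis of small
shocks requires. -/
lemma exists_shiftProblem [IsProbabilityMeasure P] (hℓ : IsLossFunction ℓ)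
    (hperm : PermutationInvariant ℓ) (hd2 : TwiceDifferentiable ℓ)
    (hX : MemOrliczHeart ℓ P X) (hY : MemOrliczHeart ℓ P Y) {m : Fin d → ℝ} {lam : ℝ}
    (hsaddle : IsSaddlePoint ℓ P X m lam) (hreg : HessianRegularAt ℓ P X m)
    (hM : IsUnit (saddleMatrix ℓ P X m lam).det) (hindep : IndepFun X Y P) :
    ∃ D c ρ, ShiftProblem (expectedLoss ℓ P X) (P.map Y) m lam D c ρ := by
  have hc : Continuous ℓ := hd2.1.continuous
  have : IsProbabilityMeasure (P.map X) := Measure.isProbabilityMeasure_map hX.1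
  set Φ : (Fin d → ℝ) → ℝ := fun x => ℓ (-x) with hΦ
  have hΦconv : ConvexOn ℝ univ Φ := convexOn_comp_neg hℓ
  have hΦanti : Antitone Φ := antitone_comp_neg hℓ
  have hneg : Differentiable ℝ (fun x : Fin d → ℝ => -x) := differentiable_id.neg
  have hΦd : Differentiable ℝ Φ := hd2.1.comp hneg
  have hΦd2 : Differentiable ℝ (fderiv ℝ Φ) := by
    have h : fderiv ℝ Φ = fun u => -fderiv ℝ ℓ (-u) := funext fun u => fderiv_comp_neg ℓ u
    rw [h]
    exact (hd2.2.comp hneg).neg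
  have hint : ∀ n, Integrable (fun x => Φ (n - x)) (P.map X) := hX.integrable_loss_map hℓ hc
  have hF : expectedLoss ℓ P X = fun n => ∫ x, Φ (n - x) ∂(P.map X) :=
    expectedLoss_eq_integral_map hc hX.1
  have hFconv : ConvexOn ℝ univ (expectedLoss ℓ P X) := hF ▸ convexOn_integral_sub hΦconv hint
  have hFanti : Antitone (expectedLoss ℓ P X) := hF ▸ antitone_integral_sub hΦanti hint
  have hFdiff : Differentiable ℝ (expectedLoss ℓ P X) := hF ▸ fun n =>
    (hasFDerivAt_integral_sub hΦconv hΦanti hΦd aemeasurable_id hint n).2.differentiableAt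
  obtain ⟨hlam, hFm, hgrad⟩ := (isSaddlePoint_iff hFconv hFdiff).1 hsaddle
  have hB : ∀ᶠ n in 𝓝 m, Integrable (fun x => fderiv ℝ (fderiv ℝ Φ) (n - x)) (P.map X) ∧
      ∫ x, fderiv ℝ (fderiv ℝ Φ) (n - x) ∂(P.map X) = bilinOfMatrix (expectedHessian ℓ P X n) :=
    hreg.1.mono fun n hn => integrable_sndFDeriv_of_hessian hX.1 hn
  have hBcont : ContinuousAt (fun n => ∫ x, fderiv ℝ (fderiv ℝ Φ) (n - x) ∂(P.map X)) m :=
    (continuousAt_bilinOfMatrix hreg.2).congr (hB.mono fun n hn => hn.2.symm)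
  obtain ⟨hBm, hDm⟩ := hB.self_of_nhds
  set D := ∫ x, fderiv ℝ (fderiv ℝ Φ) (m - x) ∂(P.map X) with hD
  have hDapp : ∀ v w, D v w = ∫ x, fderiv ℝ (fderiv ℝ Φ) (m - x) v w ∂(P.map X) := fun v w => by
    rw [hD, ContinuousLinearMap.integral_apply hBm,
      ContinuousLinearMap.integral_apply (hBm.apply_continuousLinearMap v)]
  have hDnonneg : ∀ v, 0 ≤ D v v := fun v => by
    rw [hDapp]
    exact integral_nonneg fun x => sndFDeriv_nonneg_of_convexOn hΦconv hΦd hΦd2 _ v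
  have hDsymm : ∀ v w, D v w = D w v := fun v w => by
    rw [hDapp, hDapp]
    exact integral_congr_ae (Eventually.of_forall fun x => sndFDeriv_comm hΦd hΦd2 _ v w)
  have hDpos : ∀ v ∈ LinearMap.ker (total (d := d)).toLinearMap, v ≠ 0 → 0 < D v v :=
    fun v hv hv0 => by
      refine (hDnonneg v).lt_of_ne fun h0 => hv0 ?_
      refine eq_zero_of_expectedHessian_mulVec_eq_zero hM hv ?_
      funext i
      have h1 := apply_eq_zero_of_apply_self_eq_zero hDnonneg hDsymm h0.symm (Pi.single i 1)
      rw [hDm, bilinOfMatrix_apply, Finset.sum_eq_single i (fun k _ hk => by simp [hk])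
        (fun h => absurd (Finset.mem_univ i) h)] at h1
      simpa [Matrix.mulVec, dotProduct] using h1
  obtain ⟨c, hc0, ρ, hρ, hstrong⟩ := exists_fderiv_add_sq_le hΦconv hΦanti hΦd hΦd2 hint
    (hB.mono fun n hn => hn.1) hBcont hDpos
  refine ⟨D, c, ρ, ⟨?_, hFconv, hFanti, hFdiff, ?_, fun n r hr => ?_, hlam, hFm, hgrad, ?_, hc0, hρ,
    fun z hz v hv hzv => ?_⟩⟩
  -- In dimension zero the loss is a negative constant, which excludes saddle points.
  · rcases Nat.eq_zero_or_pos d with rfl | hd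
    · obtain ⟨x, hx⟩ := hℓ.exists_neg
      have h1 : expectedLoss ℓ P X m = ℓ x := by
        simp only [expectedLoss, Subsingleton.elim _ x, integral_const, probReal_univ, one_smul]
      linarith
    · exact hd
  · exact (integrable_map_measure aestronglyMeasurable_id hY.1).2 (hY.integrable hℓ)
  · refine (integral_expectedLoss_map hℓ hc hX hY.1 hindep (f := fun y => (r * ‖y‖) • 1)
      (by fun_prop) ?_ n).1
    have h := (hY.norm_smul_one hℓ hc hperm).smul r
    simpa only [Pi.smul_def, smul_smul] using h
  · rw [hF]
    exact hasFDerivAt_fderiv_integral_sub hΦconv hΦanti hΦd hΦd2 hint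
      (hB.mono fun n hn => hn.1) hBcont
  · rw [hF]
    exact hstrong z hz v hv hzv

end Shock

/-- A point that satisfies the multiplier rule and is the only point of at most its total in the
acceptance set is the unique risk allocation, and carries the unique saddle point. -/
lemma unique_saddlePoint_and_riskAllocation {d : ℕ} (hd : 0 < d) {Ω : Type*} [MeasurableSpace Ω]
    {ℓ : (Fin d → ℝ) → ℝ} {P : Measure Ω} {X : Ω → Fin d → ℝ}
    (hconv : ConvexOn ℝ univ (expectedLoss ℓ P X))
    (hdiff : Differentiable ℝ (expectedLoss ℓ P X)) {N : Fin d → ℝ}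
    (hN : expectedLoss ℓ P X N = 0)
    (hgrad : ∃ κ > 0, ∀ v, fderiv ℝ (expectedLoss ℓ P X) N v = -(κ * total v))
    (huniq : ∀ n, expectedLoss ℓ P X n ≤ 0 → total n ≤ total N → n = N) :
    (∃! p : (Fin d → ℝ) × ℝ, IsSaddlePoint ℓ P X p.1 p.2) ∧
      (∃! n, IsRiskAllocation ℓ P X n) ∧ risk ℓ P X = total N ∧ riskAllocation ℓ P X = N := by
  have hd' : (0 : ℝ) < d := Nat.cast_pos.2 hd
  obtain ⟨κ, hκ, hgrad⟩ := hgrad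
  have hmin : ∀ {M : Fin d → ℝ} {μ : ℝ}, 0 < μ → expectedLoss ℓ P X M = 0 →
      (∀ v, fderiv ℝ (expectedLoss ℓ P X) M v = -(μ * total v)) →
      ∀ n, expectedLoss ℓ P X n ≤ 0 → total M ≤ total n := fun hμ hM hM' n hn => by
    have h1 := (neg_mul_total_le hconv hdiff hM hM' n).trans hn
    rw [neg_nonpos] at h1
    linarith [nonneg_of_mul_nonneg_right h1 hμ]
  have hrisk : risk ℓ P X = total N := by
    refine IsLeast.csInf_eq ⟨⟨N, hN.le, (total_apply N).symm⟩, ?_⟩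
    rintro _ ⟨n, hn, rfl⟩
    simpa using hmin hκ hN hgrad n hn
  have hNalloc : IsRiskAllocation ℓ P X N := ⟨hN.le, hrisk.trans (total_apply N)⟩
  have halloc : ∀ n, IsRiskAllocation ℓ P X n → n = N := fun n hn =>
    huniq n hn.1 (by rw [total_apply, ← hn.2, hrisk])
  refine ⟨⟨(N, κ⁻¹), (isSaddlePoint_iff hconv hdiff).2 ⟨inv_pos.2 hκ, hN, by rwa [inv_inv]⟩, ?_⟩,
    ⟨N, hNalloc, halloc⟩, hrisk, halloc _ (Classical.epsilon_spec ⟨N, hNalloc⟩)⟩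
  rintro ⟨n, μ⟩ hp
  obtain ⟨hμ, hn, hn'⟩ := (isSaddlePoint_iff hconv hdiff).1 hp
  obtain rfl : n = N := huniq n hn.le (hmin (inv_pos.2 hμ) hn hn' N hN.le)
  have h1 := hn' 1
  rw [hgrad, total_one, neg_inj] at h1
  have h2 : κ = μ⁻¹ := mul_right_cancel₀ hd'.ne' h1
  rw [h2, inv_inv]

end ShortfallRisk

theorem mainTheorem4 {d : ℕ} {Ω : Type*} [MeasurableSpace Ω] (P : Measure Ω)
    [IsProbabilityMeasure P] (ℓ : (Fin d → ℝ) → ℝ)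
    (hloss : ShortfallRisk.IsLossFunction ℓ)
    (hperm : ShortfallRisk.PermutationInvariant ℓ)
    (hdiff : ShortfallRisk.TwiceDifferentiable ℓ)
    (X Y : Ω → Fin d → ℝ)
    (hX : ShortfallRisk.MemOrliczHeart ℓ P X)
    (hY : ShortfallRisk.MemOrliczHeart ℓ P Y)
    (m : Fin d → ℝ) (lam : ℝ)
    (hsaddle : ShortfallRisk.IsSaddlePoint ℓ P X m lam)
    (hreg : ShortfallRisk.HessianRegularAt ℓ P X m)
    (hM : IsUnit (ShortfallRisk.saddleMatrix ℓ P X m lam).det)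
    (hindep : IndepFun X Y P) :
    (∃ t₀ : ℝ, 0 < t₀ ∧ ∀ t ∈ Set.Icc (0 : ℝ) t₀,
      (∃! p : (Fin d → ℝ) × ℝ, ShortfallRisk.IsSaddlePoint ℓ P (X + t • Y) p.1 p.2) ∧
      (∃! n : Fin d → ℝ, ShortfallRisk.IsRiskAllocation ℓ P (X + t • Y) n)) ∧
    ShortfallRisk.marginalRisk ℓ P X Y = ((∑ k, ∫ ω, Y ω k ∂P : ℝ) : EReal) ∧
    ∀ k : Fin d, ShortfallRisk.marginalAllocation ℓ P X Y k = ((∫ ω, Y ω k ∂P : ℝ) : EReal) := by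
  have hc : Continuous ℓ := hdiff.1.continuous
  have : IsProbabilityMeasure (P.map Y) := Measure.isProbabilityMeasure_map hY.1
  obtain ⟨D, c, ρ, h⟩ := ShortfallRisk.exists_shiftProblem hloss hperm hdiff hX hY hsaddle hreg hM
    hindep
  have hG := ShortfallRisk.expectedLoss_add_smul hloss hc hX hY hindep
  obtain ⟨t₀, ht₀, hmin⟩ := h.exists_unique_minimizer
  choose! N hN hgrad huniq using hmin
  have hall : ∀ t ∈ Icc (0 : ℝ) t₀, _ := fun t ht =>
    ShortfallRisk.unique_saddlePoint_and_riskAllocation (X := X + t • Y) h.dim_pos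
      (hG t ▸ h.convexOn_shiftAverage t) (hG t ▸ h.differentiable_shiftAverage t)
      (hG t ▸ hN t ht) (hG t ▸ hgrad t ht) (hG t ▸ huniq t ht)
  have hIcc : ∀ᶠ t : ℝ in 𝓝[>] 0, t ∈ Icc (0 : ℝ) t₀ :=
    mem_of_superset (Ioc_mem_nhdsGT ht₀) Ioc_subset_Icc_self
  have hmem0 : (0 : ℝ) ∈ Icc 0 t₀ := left_mem_Icc.2 ht₀.le
  have hN0 : N 0 = m := (huniq 0 hmem0 m (by
    rw [ShortfallRisk.ShiftProblem.shiftAverage_zero, h.map_eq_zero]) (by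
      have := h.total_le_of_shiftAverage_nonpos (hN 0 hmem0).le
      rwa [zero_mul, add_zero] at this)).symm
  obtain ⟨hrisk0, halloc0⟩ := (hall 0 hmem0).2.2
  rw [zero_smul, add_zero, hN0] at hrisk0 halloc0
  have hlim := h.tendsto_minimizer (hIcc.mono fun t ht => ⟨hN t ht, hgrad t ht⟩)
  have hYint : Integrable Y P := hY.integrable hloss
  have hmean : ∀ k, (∫ y, y ∂(P.map Y)) k = ∫ ω, Y ω k ∂P := fun k => by
    rw [integral_map (f := fun y : Fin d → ℝ => y) hY.1 aestronglyMeasurable_id]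
    exact eval_integral (fun i => hYint.eval i) k
  refine ⟨⟨t₀, ht₀, fun t ht => ⟨(hall t ht).1, (hall t ht).2.1⟩⟩, ?_, fun k => ?_⟩
  · have h1 := (ShortfallRisk.total.continuous.tendsto _).comp hlim
    rw [ShortfallRisk.total_apply, Finset.sum_congr rfl fun k _ => hmean k] at h1
    refine Tendsto.limsup_eq ((continuous_coe_real_ereal.tendsto _).comp (h1.congr' ?_))
    filter_upwards [hIcc] with t ht
    rw [(hall t ht).2.2.1, hrisk0, Function.comp_apply, map_smul, map_sub, smul_eq_mul,
      div_eq_inv_mul]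
  · have h1 := ((continuous_apply k).tendsto _).comp hlim
    rw [hmean k] at h1
    refine Tendsto.limsup_eq ((continuous_coe_real_ereal.tendsto _).comp (h1.congr' ?_))
    filter_upwards [hIcc] with t ht
    rw [(hall t ht).2.2.2, halloc0, Function.comp_apply, Pi.smul_apply, Pi.sub_apply, smul_eq_mul,
      div_eq_inv_mul]
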